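/- **Definitions.** An *arena* $\mathbb A=(M,\vdash,\lambda,I)$ consists of a set $M$ of moves, a relation $\vdash$ on $M$, a map $\lambda:M\to\{P,O\}$ such that $m\vdash n$ implies $\lambda(m)\ne\lambda(n)$, and a non-empty set $I\subseteq M$ of initial moves with $\lambda=O$ on $I$. Its *depth* is the least $d\in\mathbb N$ (if there is one) such that every sequence $m_1\vdash m_2\vdash\dots\vdash m_i$ with $m_1\in I$ has length at most $d$. A *play* is a finite sequence of moves, alternating between the two players $P$ and $O$, whose first move, if any, is initial and in which every non-first move $s_i$ is equipped with a pointer to some $s_j$ with $j<i$ and $s_j\vdash s_i$; the edge from $s_i$ is the pair $(s_j,s_i)$. For a player $p$, the *$p$-view* is given recursively by: the view of the empty sequence is empty; $\mathrm{view}_p(s\,a)=\mathrm{view}_p(s)\,a$ if $\lambda(a)=p$; $\mathrm{view}_p(s\,a\,s'\,c)=\mathrm{view}_p(s)\,a\,c$ if $\lambda(c)\neq p$ and $c$ points to $a$; $\mathrm{view}_p(c)=c$ if $c$ is an initial move alone and $\lambda(c)\ne p$. Views keep the pointers of the play. A *Player strategy* (resp. *Opponent strategy*) is a set of even-length (resp.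 odd-length) plays such that $s\,a\,c\in\sigma$ implies $s\in\sigma$. It is *bounded by $k\in\mathbb N$* if it is visible (for every $s\,a$ in it, with $s$ non-empty, $a$ points to a move in the view of $s$ of the strategy's owner) and the owner's view of every play in it has length at most $k$. For a Player strategy $\sigma$ and an Opponent strategy $\tau$, the set $\sigma\star\tau$ of *interactions* consists of the sequences $s\,a$ such that $s\,a\in\sigma$ and $s\in\tau$ if $\lambda(a)=P$, and $s\,a\in\tau$ and $s\in\sigma$ if $\lambda(a)=O$. In a sequence $s=s_0\dots s_r$ with pointers, the edge $(s_{m_1},s_{n_1})$ *crosses* the edge $(s_{m_2},s_{n_2})$ if $m_2<m_1<n_2<n_1$. By backward induction, an edge is *active* in $s$ if every edge of $s$ crossing it is not active in $s$. The edge from $s_j$ *inactivates* the edge from $s_i$ in $s$ if it crosses it and the edge from $s_i$ is active in $s_0\dots s_{j-1}$. The *backtracking level* of $s_i$ in $s$ is $0$ if $i=0$ or $s_i$ points to $s_{i-1}$; otherwise it is $q+1$, where $q$ is the length of the longest chain of edges $e_1,\dots,e_q$ such that each is inactivated by the next and $e_q$ is inactivated by the edge from $s_i$. The backtracking level of a sequence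 is the maximum of the levels of its moves ($0$ for the empty sequence). A bounded strategy is an *$n$-backtracking strategy* if $n$ is the maximum of the backtracking levels of its owner's views of the plays in it. Finally, let $a_0^{x}=x$ and $a_{i+1}^{x}=a^{a_i^{x}}$, and let $\log$ be the logarithm to base $2$. **Theorem.** Let $\mathbb A$ be an arena of depth $d\ge 2$, $\sigma$ a Player $n$-backtracking strategy bounded by $k$, $\tau$ an Opponent $m$-backtracking strategy bounded by $k$, and $b=\min(n,m,d-2)$. If $s=s_0\,s_1\dots s_l\in\sigma\star\tau$, then $$l\ \le\ (2k)_b^{2k}=\underbrace{(2k)^{(2k)^{\cdot^{\cdot^{\cdot^{2k}}}}}}_{b+1}\ \le\ 2_b^{\,2k(\log 2k)\cdot 2}.$$ -/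

import Mathlib

namespace CHO

/-- The two players. -/
inductive Player where
  | P
  | O
  deriving DecidableEq

/-- Arenas: a graph of moves, alternating between the two players, with initial Opponent moves,
among which there is a distinguished one. -/
structure Arena (M : Type*) where
  enables : M → M → Prop
  owner : M → Player
  initial : Set M
  star : M
  alternation : ∀ m n, enables m n → owner m ≠ owner n
  initial_owner : ∀ m ∈ initial, owner m = Player.O
  star_mem : star ∈ initial

/-- A finite sequence of moves with pointers. Positions are counted from `0`; the second component
of an entry is the position of the move that the entry points to, or `none` if it does not point
to anything. -/
abbrev PointerSeq (M : Type*) := List (M × Option ℕ)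

namespace Arena

variable {M : Type*} (A : Arena M)

/-- Simple (backtracking free) plays. -/
def IsSimplePlay (l : List M) : Prop :=
  (∃ m ∈ l.head?, m ∈ A.initial) ∧ l.IsChain A.enables

/-- `A` is of finite depth `d`: the least bound on the lengths of the simple plays is `d`. -/
def HasDepth (d : ℕ) : Prop :=
  IsLeast {k : ℕ | ∀ l : List M, A.IsSimplePlay l → l.length ≤ k} d

/-- Justified sequences: the first move is initial (and has no pointer), and every other move
points to a previous move that justifies it. -/
def IsJustified (s : PointerSeq M) : Prop :=
  ∀ (i : ℕ) (hi : i < s.length),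
    (i = 0 → s[i].1 ∈ A.initial ∧ s[i].2 = none) ∧
    (0 < i → ∃ (j : ℕ) (hj : j < i), s[i].2 = some j ∧ A.enables s[j].1 s[i].1)

/-- Plays: justified sequences in which the players alternate. The empty sequence is included. -/
def IsPlay (s : PointerSeq M) : Prop :=
  A.IsJustified s ∧ s.IsChain (fun x y => A.owner x.1 ≠ A.owner y.1)

/-- The positions in `s` of the moves of the `p`-view of the initial segment of `s` that consists
of the first `n` moves:
the view of `s ∘` is the view of `s` followed by `∘` if `∘` belongs to `p`;
the view of `s ∘ s' •` is the view of `s` followed by `∘ •` if `•` belongs to the adversary of `p`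
and points to `∘`; the view of an adversary move without pointer is that move alone. -/
def viewPos (p : Player) (s : PointerSeq M) : ℕ → List ℕ
  | 0 => []
  | n + 1 =>
    match s[n]? with
    | none => []
    | some x =>
      if A.owner x.1 = p then viewPos p s n ++ [n]
      else
        match x.2 with
        | none => [n]
        | some j => if _h : j < n then viewPos p s j ++ [j, n] else []
  termination_by n => n
  decreasing_by all_goals omega

/-- The entries of `s` at the given positions, keeping the pointers of `s`: the pointers are
renumbered according to the new positions of their targets. -/
def subSeq (s : PointerSeq M) (l : List ℕ) : PointerSeq M :=
  l.filterMap fun i => s[i]?.map fun x => (x.1, x.2.bind fun j => l.idxOf? j)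

/-- The `p`-view of `s`, as a sequence with pointers. -/
def view (p : Player) (s : PointerSeq M) : PointerSeq M :=
  subSeq s (A.viewPos p s s.length)

/-- The pointer of the entry `m`, to be played after `s`, goes to a move in the `p`-view of `s`. -/
def PointsIntoView (p : Player) (s : PointerSeq M) (m : M × Option ℕ) : Prop :=
  ∃ j ∈ A.viewPos p s s.length, m.2 = some j

/-- Player strategies: sets of even-length plays closed under even-length prefixes. -/
def IsPlayerStrategy (σ : Set (PointerSeq M)) : Prop :=
  (∀ s ∈ σ, A.IsPlay s ∧ Even s.length) ∧ ∀ s m n, s ++ [m, n] ∈ σ → s ∈ σ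

/-- Opponent strategies: sets of odd-length plays closed under odd-length prefixes. -/
def IsOpponentStrategy (τ : Set (PointerSeq M)) : Prop :=
  (∀ s ∈ τ, A.IsPlay s ∧ Odd s.length) ∧ ∀ s m n, s ++ [m, n] ∈ τ → s ∈ τ

/-- `σ` is a visible Player strategy bounded by `k`. -/
def IsBoundedPlayerStrategy (σ : Set (PointerSeq M)) (k : ℕ) : Prop :=
  A.IsPlayerStrategy σ ∧
  (∀ s m, s ++ [m] ∈ σ → A.PointsIntoView Player.P s m) ∧
  ∀ s ∈ σ, (A.view Player.P s).length ≤ k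

/-- `τ` is a visible Opponent strategy bounded by `k`. -/
def IsBoundedOpponentStrategy (τ : Set (PointerSeq M)) (k : ℕ) : Prop :=
  A.IsOpponentStrategy τ ∧
  (∀ s m, s ≠ [] → s ++ [m] ∈ τ → A.PointsIntoView Player.O s m) ∧
  ∀ s ∈ τ, (A.view Player.O s).length ≤ k

/-- The set of interactions between `σ` and `τ`. -/
def interactions (σ τ : Set (PointerSeq M)) : Set (PointerSeq M) :=
  {t | ∃ s m, t = s ++ [m] ∧
    (A.owner m.1 = Player.P → s ++ [m] ∈ σ ∧ s ∈ τ) ∧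
    (A.owner m.1 = Player.O → s ++ [m] ∈ τ ∧ s ∈ σ)}

end Arena

section Backtracking

variable {M : Type*}

/-- The position that the move at position `i` of `s` points to. The edge from this move is
represented by the position `i`. -/
def pointer (s : PointerSeq M) (i : ℕ) : Option ℕ := s[i]?.bind Prod.snd

/-- The edge from `i` is crossed by the edge from `j`. -/
def CrossedBy (s : PointerSeq M) (i j : ℕ) : Prop :=
  ∃ a b, pointer s i = some a ∧ pointer s j = some b ∧ a < b ∧ b < i ∧ i < j

/-- The edge from `i` is active in `s`: all the edges that cross it are inactive in `s`
(backward induction on positions). -/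
def Active (s : PointerSeq M) (i : ℕ) : Prop :=
  ∀ j, i < j ∧ j < s.length → CrossedBy s i j → ¬ Active s j
  termination_by s.length - i
  decreasing_by omega

/-- The edge from `i` is inactivated by the edge from `j` in `s`: the latter crosses the former,
which is active in the initial segment of `s` consisting of the moves before `j`. -/
def InactivatedBy (s : PointerSeq M) (i j : ℕ) : Prop :=
  CrossedBy s i j ∧ Active (s.take j) i

/-- The backtracking level in `s` of the move at position `i`: `0` for the first move and for a
move that points to the immediately preceding one, otherwise `k + 1`, where `k` is the length of
the longest chain of edges, each inactivated by the next one, with the last inactivated by the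
edge from `i`. -/
noncomputable def moveLevel (s : PointerSeq M) (i : ℕ) : ℕ :=
  open Classical in
  if i = 0 ∨ pointer s i = some (i - 1) then 0
  else sSup {k : ℕ | ∃ c : List ℕ, c.length = k ∧ (c ++ [i]).IsChain (InactivatedBy s)} + 1

/-- The backtracking level of a sequence with pointers: the maximum of the levels of its moves. -/
noncomputable def level (s : PointerSeq M) : ℕ :=
  (Finset.range s.length).sup (moveLevel s)

/-- The backtracking level of the strategy `σ` of the player `p` is `n`: the maximum of the levels
of the `p`-views of the plays in `σ` is `n`. -/
def IsBacktracking (A : Arena M) (p : Player) (σ : Set (PointerSeq M)) (n : ℕ) : Prop :=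
  IsGreatest {k : ℕ | ∃ s ∈ σ, level (A.view p s) = k} n

end Backtracking

/-- The hyperexponential function: `hyperexp a 0 x = x` and
`hyperexp a (n + 1) x = a ^ hyperexp a n x`. -/
noncomputable def hyperexp (a : ℝ) : ℕ → ℝ → ℝ
  | 0, x => x
  | n + 1, x => a ^ hyperexp a n x

end CHO

open CHO

namespace CHO

/-! The number of positions of the interaction is bounded by towers of height governed by `n`, by
`m` and by `d - 2`; the minimum then comes for free. All three bounds have the same shape: a parent
function turns the positions into a tree with at most `k` children per node, whose branches are
again plays with visible players and views of length at most `k`, but with the parameter lowered by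
one. If branches have at most `f + 1` positions, the tree has at most `(f + 1) * k ^ f ≤ (2 * k) ^
f` nodes, which is one more exponential.

For the level of a player `b`, the parent `skip` is the preceding position, except that a move of
`b` of maximal level has its target as parent. An edge of maximal level that was crossed inside a
view would yield a move of still higher level (`not_cross_top`). So skipping hides whole stretches
of the view of `b` without cutting pointers or changing activity, leaves the adversary's views
alone, and lowers the level (`good_skip`, `not_levGE_skip`). Siblings are collected in one view of
`b`, which gives the branching bound. At level `0` the adversary's view is the whole play.

For the depth, the moves of maximal depth `D` are removed from the branches, each with everything
back to and including its target; the parent is `cut`. A target that has been removed cannot be used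
again, so the leaves inject into the other positions (`card_leaves`) and cost only a factor `2`.

A play is encoded as the descending chain `x`, `pr x`, `pr (pr x)`, ..., and a view as another
descending chain (`anc` of `st`). Branches of the trees are then plays without any renumbering;
`Represents` links this encoding to levels of actual views. -/

/-- The positions reached from `x` by iterating `f` as long as it decreases. -/
def anc (f : ℕ → ℕ) (x : ℕ) : Finset ℕ :=
  insert x (if _h : f x < x then anc f (f x) else ∅)
  termination_by x

/-! ### Descending chains of positions. -/

section Ancestors

variable {f g : ℕ → ℕ} {x y z w : ℕ}

theorem self_mem_anc (f : ℕ → ℕ) (x : ℕ) : x ∈ anc f x := by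
  rw [anc]; exact Finset.mem_insert_self _ _

theorem anc_of_lt (h : f x < x) : anc f x = insert x (anc f (f x)) := by
  rw [anc, dif_pos h]

theorem anc_of_not_lt (h : ¬ f x < x) : anc f x = {x} := by
  rw [anc, dif_neg h]; rfl

theorem anc_zero : anc f 0 = {0} := anc_of_not_lt (by omega)

theorem mem_anc_iff : z ∈ anc f x ↔ z = x ∨ (f x < x ∧ z ∈ anc f (f x)) := by
  by_cases h : f x < x
  · rw [anc_of_lt h]; simp [h]
  · rw [anc_of_not_lt h]; simp [h]

theorem le_of_mem_anc (h : z ∈ anc f x) : z ≤ x := by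
  induction x using Nat.strong_induction_on with
  | _ x ih =>
    rcases mem_anc_iff.1 h with rfl | ⟨h1, h2⟩
    · exact le_rfl
    · exact (ih _ h1 h2).trans h1.le

theorem anc_subset (h : z ∈ anc f x) : anc f z ⊆ anc f x := by
  induction x using Nat.strong_induction_on with
  | _ x ih =>
    rcases mem_anc_iff.1 h with rfl | ⟨h1, h2⟩
    · exact subset_rfl
    · exact (ih _ h1 h2).trans (by rw [anc_of_lt h1]; exact Finset.subset_insert _ _)

/-- `anc f x` is a single descending path, so whatever lies on it below `z` is reached through `z`.
-/
theorem mem_anc_of_le (hz : z ∈ anc f x) (hw : w ∈ anc f x) (h : w ≤ z) : w ∈ anc f z := by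
  induction x using Nat.strong_induction_on with
  | _ x ih =>
    rcases mem_anc_iff.1 hz with rfl | ⟨h1, h2⟩
    · exact hw
    · rcases mem_anc_iff.1 hw with rfl | ⟨_, h3⟩
      · have := le_of_mem_anc h2; omega
      · exact ih _ h1 h2 h3

theorem exists_child (hz : z ∈ anc f x) (hne : z ≠ x) : ∃ u ∈ anc f x, f u = z ∧ z < u := by
  induction x using Nat.strong_induction_on with
  | _ x ih =>
    rcases mem_anc_iff.1 hz with rfl | ⟨h1, h2⟩
    · exact absurd rfl hne
    · by_cases hzx : z = f x
      · exact ⟨x, self_mem_anc _ _, hzx.symm, hzx ▸ h1⟩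
      · obtain ⟨u, hu, h3⟩ := ih _ h1 h2 hzx
        exact ⟨u, mem_anc_iff.2 (Or.inr ⟨h1, hu⟩), h3⟩

theorem mem_anc_next (hz : z ∈ anc f x) (hw : w ∈ anc f x) (h : w < z) :
    f z < z ∧ w ∈ anc f (f z) := by
  rcases mem_anc_iff.1 (mem_anc_of_le hz hw h.le) with rfl | h'
  · exact absurd h (lt_irrefl _)
  · exact h'

theorem next_mem_anc (hz : z ∈ anc f x) (h : f z < z) : f z ∈ anc f x :=
  anc_subset hz (mem_anc_iff.2 (Or.inr ⟨h, self_mem_anc _ _⟩))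

theorem anc_congr (h : ∀ y ∈ anc f x, y ≠ 0 → f y = g y) : anc f x = anc g x := by
  induction x using Nat.strong_induction_on with
  | _ x ih =>
    rcases Nat.eq_zero_or_pos x with rfl | hx
    · rw [anc_zero, anc_zero]
    have hfg := h x (self_mem_anc _ _) hx.ne'
    by_cases h1 : f x < x
    · rw [anc_of_lt h1, anc_of_lt (f := g) (hfg ▸ h1), ← hfg, ih _ h1 fun y hy =>
        h y (mem_anc_iff.2 (Or.inr ⟨h1, hy⟩))]
    · rw [anc_of_not_lt h1, anc_of_not_lt (f := g) (hfg ▸ h1)]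

theorem card_anc_of_lt (h : f x < x) : (anc f x).card = (anc f (f x)).card + 1 := by
  rw [anc_of_lt h, Finset.card_insert_of_notMem]
  intro h'; have := le_of_mem_anc h'; omega

theorem card_anc_pos : 0 < (anc f x).card := Finset.card_pos.2 ⟨x, self_mem_anc _ _⟩

end Ancestors

/-! ### Counting in trees, and stacks. -/

/-- A tree of bounded height and bounded branching has boundedly many nodes. -/
theorem card_le_of_tree (S : Finset ℕ) (q : ℕ → ℕ) (F k : ℕ)
    (hq : ∀ y ∈ S, y ≠ 0 → q y < y ∧ q y ∈ S) (hF : ∀ y ∈ S, (anc q y).card ≤ F)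
    (hk : ∀ a ∈ S, (S.filter fun y => y ≠ 0 ∧ q y = a).card ≤ k) :
    S.card ≤ ∑ h ∈ Finset.range F, k ^ h := by
  classical
  -- Nodes with `h + 1` ancestors lie `h` steps below the only possible root, `0`.
  have hlev : ∀ h, (S.filter fun y => (anc q y).card = h + 1).card ≤ k ^ h := by
    intro h
    induction h with
    | zero =>
      refine (Finset.card_le_card (t := {0}) ?_).trans (by simp)
      intro y hy
      rw [Finset.mem_filter] at hy
      by_contra hne
      have h0 : y ≠ 0 := by simpa using hne
      have := card_anc_of_lt (hq y hy.1 h0).1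
      have := card_anc_pos (f := q) (x := q y)
      omega
    | succ h ih =>
      have hne : ∀ y, (anc q y).card = h + 1 + 1 → y ≠ 0 := by
        rintro y hy rfl
        rw [anc_zero] at hy; simp at hy
      refine (Finset.card_le_mul_card_image_of_maps_to (f := q)
        (t := S.filter fun y => (anc q y).card = h + 1) ?_ k ?_).trans ?_
      · intro y hy
        rw [Finset.mem_filter] at hy ⊢
        have h1 := hq y hy.1 (hne y hy.2)
        have := card_anc_of_lt h1.1
        exact ⟨h1.2, by omega⟩
      · intro a ha
        refine (Finset.card_le_card ?_).trans (hk a (Finset.mem_filter.1 ha).1)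
        intro y hy
        simp only [Finset.mem_filter] at hy ⊢
        exact ⟨hy.1.1, hne y hy.1.2, hy.2⟩
      · rw [pow_succ, mul_comm]
        exact Nat.mul_le_mul_right _ ih
  rw [Finset.card_eq_sum_card_fiberwise (f := fun y => (anc q y).card - 1)
    (t := Finset.range F)]
  · refine Finset.sum_le_sum fun h _ => (Finset.card_le_card ?_).trans (hlev h)
    intro y hy
    simp only [Finset.mem_filter] at hy ⊢
    have := card_anc_pos (f := q) (x := y)
    exact ⟨hy.1, by omega⟩
  · intro y hy
    have := hF y hy
    have := card_anc_pos (f := q) (x := y)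
    simp only [Finset.coe_range, Set.mem_Iio]
    omega

theorem sum_pow_le (k f : ℕ) (hk : 1 ≤ k) :
    ∑ h ∈ Finset.range (f + 1), k ^ h ≤ (f + 1) * k ^ f := by
  refine (Finset.sum_le_card_nsmul _ _ (k ^ f) fun h hh => ?_).trans (by simp)
  exact Nat.pow_le_pow_right hk (by simpa [Nat.lt_succ_iff] using hh)

/-- Elements that are popped from a stack never come back. -/
theorem mem_stack_of_le {pr : ℕ → ℕ} {x : ℕ} {R : ℕ → Finset ℕ}
    (hpr : ∀ y ∈ anc pr x, y ≠ 0 → pr y < y)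
    (hR : ∀ y ∈ anc pr x, y ≠ 0 → ∀ z ∈ R y, z = y ∨ z ∈ R (pr y))
    {u w z : ℕ} (hu : u ∈ anc pr x) (hw : w ∈ anc pr x) (huw : u ≤ w) (hz : z ∈ R w)
    (hzu : z ≤ u) : z ∈ R u := by
  induction w using Nat.strong_induction_on with
  | _ w ih =>
    rcases huw.eq_or_lt with rfl | hlt
    · exact hz
    · have hw0 : w ≠ 0 := by omega
      have hlt' := hpr w hw hw0
      have hu' := (mem_anc_next hw hu hlt).2
      rcases hR w hw hw0 z hz with rfl | h
      · omega
      · exact ih _ hlt' (next_mem_anc hw hlt') (le_of_mem_anc hu') h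

/-! ### Plays and views as descending chains. -/

variable {B : ℕ → Bool} {pr pt : ℕ → ℕ} {k x : ℕ}

/-- The step to the previous move of the view of the player `b`. -/
def st (B : ℕ → Bool) (pr pt : ℕ → ℕ) (b : Bool) (y : ℕ) : ℕ := if B y = b then pr y else pt y

/-- The moves `x`, `pr x`, `pr (pr x)`, ... form, in reverse order, a play with pointers `pt` and
owners `B`, in which both players are visible and have views of length at most `k`. -/
structure Good (B : ℕ → Bool) (pr pt : ℕ → ℕ) (k x : ℕ) : Prop where
  pr_lt : ∀ y ∈ anc pr x, y ≠ 0 → pr y < y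
  owner_pr : ∀ y ∈ anc pr x, y ≠ 0 → B (pr y) = !B y
  owner_pt : ∀ y ∈ anc pr x, y ≠ 0 → B (pt y) = !B y
  visible : ∀ y ∈ anc pr x, y ≠ 0 → pt y ∈ anc (st B pr pt (B y)) (pr y)
  bounded : ∀ y ∈ anc pr x, (anc (st B pr pt (B y)) y).card ≤ k

theorem st_own {b : Bool} {y : ℕ} (h : B y = b) : st B pr pt b y = pr y := if_pos h
theorem st_other {b : Bool} {y : ℕ} (h : B y ≠ b) : st B pr pt b y = pt y := if_neg h

namespace Good

theorem of_mem (h : Good B pr pt k x) {y : ℕ} (hy : y ∈ anc pr x) : Good B pr pt k y :=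
  ⟨fun z hz => h.pr_lt z (anc_subset hy hz), fun z hz => h.owner_pr z (anc_subset hy hz),
    fun z hz => h.owner_pt z (anc_subset hy hz), fun z hz => h.visible z (anc_subset hy hz),
    fun z hz => h.bounded z (anc_subset hy hz)⟩

theorem view_subset (h : Good B pr pt k x) (b : Bool) : anc (st B pr pt b) x ⊆ anc pr x := by
  induction x using Nat.strong_induction_on generalizing b with
  | _ x ih =>
    rcases Nat.eq_zero_or_pos x with rfl | hx
    · rw [anc_zero, anc_zero]
    have hlt := h.pr_lt x (self_mem_anc _ _) hx.ne'
    have hprm := next_mem_anc (self_mem_anc pr x) hlt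
    have hpt := ih _ hlt (h.of_mem hprm) _ (h.visible x (self_mem_anc _ _) hx.ne')
    intro z hz
    rcases mem_anc_iff.1 hz with rfl | ⟨h1, h2⟩
    · exact self_mem_anc _ _
    · by_cases hB : B x = b
      · rw [st_own hB] at h1 h2
        exact anc_subset hprm (ih _ h1 (h.of_mem hprm) b h2)
      · rw [st_other hB] at h1 h2
        have hptm := anc_subset hprm hpt
        exact anc_subset hptm (ih _ h1 (h.of_mem hptm) b h2)

theorem pr_mem (h : Good B pr pt k x) {y : ℕ} (hy : y ∈ anc pr x) (h0 : y ≠ 0) :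
    pr y ∈ anc pr x := next_mem_anc hy (h.pr_lt y hy h0)

theorem pt_mem (h : Good B pr pt k x) {y : ℕ} (hy : y ∈ anc pr x) (h0 : y ≠ 0) :
    pt y ∈ anc pr x :=
  anc_subset (h.pr_mem hy h0) ((h.of_mem (h.pr_mem hy h0)).view_subset _ (h.visible y hy h0))

theorem pt_lt (h : Good B pr pt k x) {y : ℕ} (hy : y ∈ anc pr x) (h0 : y ≠ 0) : pt y < y :=
  (le_of_mem_anc (h.visible y hy h0)).trans_lt (h.pr_lt y hy h0)

theorem st_lt (h : Good B pr pt k x) (b : Bool) {y : ℕ} (hy : y ∈ anc pr x) (h0 : y ≠ 0) :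
    st B pr pt b y < y := by
  unfold st; split_ifs
  · exact h.pr_lt y hy h0
  · exact h.pt_lt hy h0

theorem st_mem (h : Good B pr pt k x) (b : Bool) {y : ℕ} (hy : y ∈ anc pr x) (h0 : y ≠ 0) :
    st B pr pt b y ∈ anc pr x := by
  unfold st; split_ifs
  · exact h.pr_mem hy h0
  · exact h.pt_mem hy h0

theorem owner_st (h : Good B pr pt k x) (b : Bool) {y : ℕ} (hy : y ∈ anc pr x) (h0 : y ≠ 0) :
    B (st B pr pt b y) = !B y := by
  unfold st; split_ifs
  · exact h.owner_pr y hy h0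
  · exact h.owner_pt y hy h0

theorem mem_of_mem_view (h : Good B pr pt k x) {b : Bool} {y z : ℕ} (hy : y ∈ anc pr x)
    (hz : z ∈ anc (st B pr pt b) y) : z ∈ anc pr x :=
  anc_subset hy ((h.of_mem hy).view_subset b hz)

/-- At a move of `b` this is visibility; at an adversary move the view of `b` steps to the target
itself. Hence pointers of moves in a view stay inside that view. -/
theorem pt_mem_view (h : Good B pr pt k x) {y : ℕ} (hy : y ∈ anc pr x) (h0 : y ≠ 0) (b : Bool) :
    pt y ∈ anc (st B pr pt b) (st B pr pt b y) := by
  by_cases hB : B y = b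
  · rw [st_own hB, ← hB]; exact h.visible y hy h0
  · rw [st_other hB]; exact self_mem_anc _ _

end Good

/-- Tower of exponentials of natural numbers. -/
def tower (a : ℕ) : ℕ → ℕ
  | 0 => a
  | n + 1 => a ^ tower a n

theorem le_tower (a n : ℕ) (ha : 2 ≤ a) : a ≤ tower a n := by
  induction n with
  | zero => exact le_rfl
  | succ n ih =>
    show a ≤ a ^ tower a n
    exact Nat.le_self_pow (by omega) a

end CHO

/-! ### The bound by the backtracking level. -/

namespace CHO

variable {B : ℕ → Bool} {pr pt : ℕ → ℕ} {k x : ℕ}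

/-- The edge from `c` is crossed by the edge from `y`. -/
def Cross (pt : ℕ → ℕ) (c y : ℕ) : Prop := pt c < pt y ∧ pt y < c ∧ c < y

/-- The edge from `i` is active in the sequence formed by the positions in `W`. -/
def Act (pt : ℕ → ℕ) (W : Finset ℕ) (i : ℕ) : Prop :=
  ∀ j, (_h : j ∈ W ∧ i < j) → Cross pt i j → ¬ Act pt W j
  termination_by W.sup id + 1 - i
  decreasing_by
    have : id j ≤ W.sup id := Finset.le_sup _h.1
    simp only [id] at this
    have := _h.2
    omega

theorem act_iff {W : Finset ℕ} {i : ℕ} :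
    Act pt W i ↔ ∀ j ∈ W, Cross pt i j → ¬ Act pt W j := by
  rw [Act]
  exact ⟨fun h j hj hc => h j ⟨hj, hc.2.2⟩ hc, fun h j hj hc => h j hj.1 hc⟩

/-- The level of the move at `y`, with respect to the view that is given by `f`, is at least
the given number. -/
def LevGE (pt f : ℕ → ℕ) : ℕ → ℕ → Prop
  | 0, _ => True
  | 1, y => pt y ≠ f y
  | n + 2, y => ∃ c ∈ anc f (f y), Cross pt c y ∧ Act pt (anc f (f y)) c ∧ LevGE pt f (n + 1) c

theorem LevGE.ne_next {f : ℕ → ℕ} {n y : ℕ} (h : LevGE pt f (n + 1) y) : pt y ≠ f y := by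
  rcases n with _ | n
  · exact h
  · obtain ⟨c, hc, hcr, -⟩ := h
    have := le_of_mem_anc hc
    have := hcr.2.1
    omega

/-- The step function that skips everything between an edge of level `n` of the player `b` and
its target. -/
noncomputable def skip (B : ℕ → Bool) (pr pt : ℕ → ℕ) (b : Bool) (n : ℕ) (y : ℕ) : ℕ :=
  open Classical in if B y = b ∧ LevGE pt (st B pr pt b) n y then pt y else pr y

namespace Good

/-- In the view of `b` an adversary move always points to its immediate predecessor, so it has level
`0`. -/
theorem owner_of_levGE {b : Bool} {n y : ℕ} (hl : LevGE pt (st B pr pt b) (n + 1) y) : B y = b := by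
  by_contra hB
  exact hl.ne_next (st_other hB).symm

/-- In a view, edges of maximal level are not crossed. -/
theorem not_cross_top (h : Good B pr pt k x) {b : Bool} {n e : ℕ} (hx0 : x ≠ 0)
    (hlev : ∀ y ∈ anc pr x, y ≠ 0 → B y = b → ¬ LevGE pt (st B pr pt b) (n + 2) y)
    (he : LevGE pt (st B pr pt b) (n + 1) e) (hem : e ∈ anc (st B pr pt b) (st B pr pt b x)) :
    ¬ Cross pt e x := by
  induction x using Nat.strong_induction_on with
  | _ x ih =>
    intro hc
    have hx := self_mem_anc pr x
    have hlt := h.st_lt b hx hx0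
    have hstm := h.st_mem b hx hx0
    have hl : LevGE pt (st B pr pt b) (n + 2) x := by
      -- By induction nothing before `x` in the view crosses `e`, so `e` is active there, and
      -- crossing it would give `x` a level above the maximum.
      refine ⟨e, hem, hc, act_iff.2 fun j hj hcj => ?_, he⟩
      have hej := hcj.2.2
      have hjx := (le_of_mem_anc hj).trans_lt hlt
      have hjm := h.mem_of_mem_view hstm hj
      exact absurd hcj (ih j hjx (h.of_mem hjm) (by omega)
        (fun y hy => hlev y (anc_subset hjm hy)) (mem_anc_next hj hem hej).2)
    exact hlev x hx hx0 (owner_of_levGE hl) hl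

end Good

theorem skip_top {b : Bool} {n y : ℕ} (h1 : B y = b) (h2 : LevGE pt (st B pr pt b) n y) :
    skip B pr pt b n y = pt y := if_pos ⟨h1, h2⟩

theorem skip_of_not {b : Bool} {n y : ℕ} (h : ¬ (B y = b ∧ LevGE pt (st B pr pt b) n y)) :
    skip B pr pt b n y = pr y := if_neg h

/-- `skip` differs from `pr` only at moves of `b`, and there the adversary's view follows `pt`. -/
theorem st_skip_not (b : Bool) (n : ℕ) :
    st B (skip B pr pt b n) pt (!b) = st B pr pt (!b) := by
  funext y
  by_cases hB : B y = !b
  · rw [st_own hB, st_own hB, skip_of_not]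
    rintro ⟨h, -⟩
    simp [h] at hB
  · rw [st_other hB, st_other hB]

theorem st_skip_top {b : Bool} {n y : ℕ} (h1 : B y = b) (h2 : LevGE pt (st B pr pt b) n y) :
    st B (skip B pr pt b n) pt b y = pt y := by
  rw [st_own h1, skip_top h1 h2]

theorem st_skip_of_not {b : Bool} {n y : ℕ} (h : ¬ (B y = b ∧ LevGE pt (st B pr pt b) n y)) :
    st B (skip B pr pt b n) pt b y = st B pr pt b y := by
  by_cases hB : B y = b
  · rw [st_own hB, st_own hB, skip_of_not h]
  · rw [st_other hB, st_other hB]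

namespace Good

section Skip

variable {b : Bool} {n : ℕ}

/-- Skipping removes from a view the positions that lie strictly between an edge of maximal level
and its target. -/
theorem mem_view_skip (h : Good B pr pt k x)
    (hlev : ∀ y ∈ anc pr x, y ≠ 0 → B y = b → ¬ LevGE pt (st B pr pt b) (n + 2) y) (z : ℕ) :
    z ∈ anc (st B (skip B pr pt b (n + 1)) pt b) x ↔
      z ∈ anc (st B pr pt b) x ∧
        ∀ e ∈ anc (st B pr pt b) x, e ≠ 0 → LevGE pt (st B pr pt b) (n + 1) e →
          ¬ (pt e < z ∧ z < e) := by
  induction x using Nat.strong_induction_on with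
  | _ x ih =>
    rcases Nat.eq_zero_or_pos x with rfl | hx
    · simp only [anc_zero, Finset.mem_singleton]
      exact ⟨fun hz => ⟨hz, fun e he h0 => absurd he h0⟩, fun hz => hz.1⟩
    have hxm := self_mem_anc pr x
    have hst := h.st_lt b hxm hx.ne'
    have hstm := h.st_mem b hxm hx.ne'
    have hptlt := h.pt_lt hxm hx.ne'
    have hptm := h.pt_mem hxm hx.ne'
    have hV := anc_of_lt (f := st B pr pt b) hst
    by_cases htop : B x = b ∧ LevGE pt (st B pr pt b) (n + 1) x
    · rw [anc_of_lt (f := st B (skip B pr pt b (n + 1)) pt b)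
        (by rw [st_skip_top htop.1 htop.2]; exact hptlt), st_skip_top htop.1 htop.2,
        Finset.mem_insert, ih _ hptlt (h.of_mem hptm) fun y hy => hlev y (anc_subset hptm hy)]
      have hptV := h.pt_mem_view hxm hx.ne' b
      constructor
      · rintro (rfl | ⟨h1, h2⟩)
        · refine ⟨self_mem_anc _ _, fun e he _ _ h' => ?_⟩
          have := le_of_mem_anc he; omega
        · have hzle := le_of_mem_anc h1
          refine ⟨by rw [hV]; exact Finset.mem_insert_of_mem (anc_subset hptV h1), ?_⟩
          intro e he he0 hel hsp
          rcases mem_anc_iff.1 he with rfl | ⟨-, he'⟩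
          · omega
          · by_cases hle : e ≤ pt x
            · exact h2 e (mem_anc_of_le hptV he' hle) he0 hel hsp
            -- A top edge that starts strictly between `pt x` and `x` and passes over `z` would be
            -- crossed by the edge from `x`.
            · have := le_of_mem_anc he'
              exact h.not_cross_top hx.ne' hlev hel he' ⟨by omega, by omega, by omega⟩
      · rintro ⟨h1, h2⟩
        rcases mem_anc_iff.1 h1 with rfl | ⟨-, h1'⟩
        · exact Or.inl rfl
        · right
          have := le_of_mem_anc h1'
          have := h2 x (self_mem_anc _ _) hx.ne' htop.2
          exact ⟨mem_anc_of_le hptV h1' (by omega), fun e he => h2 e (by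
            rw [hV]; exact Finset.mem_insert_of_mem (anc_subset hptV he))⟩
    · rw [anc_of_lt (f := st B (skip B pr pt b (n + 1)) pt b)
        (by rw [st_skip_of_not htop]; exact hst), st_skip_of_not htop,
        Finset.mem_insert, ih _ hst (h.of_mem hstm) fun y hy => hlev y (anc_subset hstm hy), hV]
      constructor
      · rintro (rfl | ⟨h1, h2⟩)
        · refine ⟨Finset.mem_insert_self _ _, fun e he _ _ h' => ?_⟩
          rw [← hV] at he
          have := le_of_mem_anc he; omega
        · refine ⟨Finset.mem_insert_of_mem h1, fun e he he0 hel => ?_⟩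
          rcases Finset.mem_insert.1 he with rfl | he'
          · exact absurd ⟨owner_of_levGE hel, hel⟩ htop
          · exact h2 e he' he0 hel
      · rintro ⟨h1, h2⟩
        rcases Finset.mem_insert.1 h1 with rfl | h1'
        · exact Or.inl rfl
        · exact Or.inr ⟨h1', fun e he => h2 e (Finset.mem_insert_of_mem he)⟩

variable (h : Good B pr pt k x)
    (hlev : ∀ y ∈ anc pr x, y ≠ 0 → B y = b → ¬ LevGE pt (st B pr pt b) (n + 2) y)
include h

include hlev

theorem view_skip_subset {y : ℕ} (hy : y ∈ anc pr x) :
    anc (st B (skip B pr pt b (n + 1)) pt b) y ⊆ anc (st B pr pt b) y := fun z hz =>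
  (((h.of_mem hy).mem_view_skip (fun w hw => hlev w (anc_subset hy hw)) z).1 hz).1

/-- A target hidden below a top edge would mean that the edge from `y` crosses that top edge. -/
theorem pt_mem_view_skip {y : ℕ} (hy : y ∈ anc pr x) (h0 : y ≠ 0) :
    pt y ∈ anc (st B (skip B pr pt b (n + 1)) pt b)
      (st B (skip B pr pt b (n + 1)) pt b y) := by
  by_cases htop : B y = b ∧ LevGE pt (st B pr pt b) (n + 1) y
  · rw [st_skip_top htop.1 htop.2]; exact self_mem_anc _ _
  · rw [st_skip_of_not htop]
    have hstm := h.st_mem b hy h0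
    rw [(h.of_mem hstm).mem_view_skip fun w hw => hlev w (anc_subset hstm hw)]
    refine ⟨h.pt_mem_view hy h0 b, fun e he _ hel hsp => ?_⟩
    have := le_of_mem_anc he
    have := h.st_lt b hy h0
    exact (h.of_mem hy).not_cross_top h0 (fun w hw => hlev w (anc_subset hy hw)) hel he
      ⟨hsp.1, hsp.2, by omega⟩

omit hlev in
theorem skip_lt {y : ℕ} (hy : y ∈ anc pr x) (h0 : y ≠ 0) : skip B pr pt b (n + 1) y < y := by
  unfold skip; split_ifs
  · exact h.pt_lt hy h0
  · exact h.pr_lt y hy h0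

omit hlev in
theorem skip_mem {y : ℕ} (hy : y ∈ anc pr x) (h0 : y ≠ 0) :
    skip B pr pt b (n + 1) y ∈ anc pr x := by
  unfold skip; split_ifs
  · exact h.pt_mem hy h0
  · exact h.pr_mem hy h0

omit hlev in
theorem anc_skip_subset {y : ℕ} (hy : y ∈ anc pr x) :
    anc (skip B pr pt b (n + 1)) y ⊆ anc pr x := by
  induction y using Nat.strong_induction_on with
  | _ y ih =>
    intro z hz
    rcases mem_anc_iff.1 hz with rfl | ⟨h1, h2⟩
    · exact hy
    · exact ih _ h1 (h.skip_mem hy (by omega)) h2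

theorem good_skip {y : ℕ} (hy : y ∈ anc pr x) : Good B (skip B pr pt b (n + 1)) pt k y where
  pr_lt z hz h0 := h.skip_lt (h.anc_skip_subset hy hz) h0
  owner_pr z hz h0 := by
    have hz' := h.anc_skip_subset hy hz
    unfold skip; split_ifs
    · exact h.owner_pt z hz' h0
    · exact h.owner_pr z hz' h0
  owner_pt z hz h0 := h.owner_pt z (h.anc_skip_subset hy hz) h0
  visible z hz h0 := by
    have hz' := h.anc_skip_subset hy hz
    by_cases hB : B z = b
    · have := h.pt_mem_view_skip hlev hz' h0
      rw [st_own hB] at this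
      rwa [hB]
    · rw [skip_of_not fun h' => hB h'.1]
      obtain hB' : B z = !b := by revert hB; cases B z <;> cases b <;> simp
      rw [hB', st_skip_not, ← hB']
      exact h.visible z hz' h0
  bounded z hz := by
    have hz' := h.anc_skip_subset hy hz
    by_cases hB : B z = b
    · rw [hB]
      exact (Finset.card_le_card (h.view_skip_subset hlev hz')).trans (hB ▸ h.bounded z hz')
    · obtain hB' : B z = !b := by revert hB; cases B z <;> cases b <;> simp
      rw [hB', st_skip_not, ← hB']
      exact h.bounded z hz'

/-- Skipping does not change which edges are active. -/
theorem act_skip {w : ℕ} (hw : w ∈ anc pr x) {c : ℕ}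
    (hc : c ∈ anc (st B (skip B pr pt b (n + 1)) pt b) w) :
    Act pt (anc (st B (skip B pr pt b (n + 1)) pt b) w) c ↔ Act pt (anc (st B pr pt b) w) c := by
  induction hm : w - c using Nat.strong_induction_on generalizing c with
  | _ m ih =>
    subst hm
    have hlevw := fun y hy => hlev y (anc_subset hw hy)
    have ih' : ∀ j ∈ anc (st B (skip B pr pt b (n + 1)) pt b) w, c < j →
        (Act pt (anc (st B (skip B pr pt b (n + 1)) pt b) w) j ↔
          Act pt (anc (st B pr pt b) w) j) := fun j hj hcj =>
      ih (w - j) (by have := le_of_mem_anc hj; omega) hj rfl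
    constructor
    · intro ha
      refine act_iff.2 fun j hj hcj => ?_
      by_cases hj' : j ∈ anc (st B (skip B pr pt b (n + 1)) pt b) w
      · rw [← ih' j hj' hcj.2.2]
        exact act_iff.1 ha j hj' hcj
      · rw [(h.of_mem hw).mem_view_skip hlevw] at hj' hc
        push Not at hj'
        -- The hidden `j` lies below a top edge `e`, while `c` does not, so `c ≤ pt e` and `e`
        -- crosses `j`. Being uncrossed, `e` is active, hence `j` is inactive and does no harm to
        -- `c`.
        obtain ⟨e, he, he0, hel, h1, h2⟩ := hj' hj
        have h3 := hc.2 e he he0 hel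
        intro haj
        refine act_iff.1 haj e he ⟨?_, h1, h2⟩ (act_iff.2 fun i hi hci => ?_)
        · have := hcj.2.1; have := hcj.2.2; omega
        · have hi' := h.mem_of_mem_view hw hi
          have := hci.2.2
          exact absurd hci ((h.of_mem hi').not_cross_top (by omega)
            (fun y hy => hlev y (anc_subset hi' hy)) hel (mem_anc_next hi he hci.2.2).2)
    · intro ha
      refine act_iff.2 fun j hj hcj => ?_
      rw [ih' j hj hcj.2.2]
      exact act_iff.1 ha j (h.view_skip_subset hlev hw hj) hcj

/-- A chain of inactivations in the thinned view is also one in the full view: activity agrees, and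
no link is a top edge because links are crossed. -/
theorem levGE_of_skip {j y : ℕ} (hy : y ∈ anc pr x) (h0 : y ≠ 0)
    (hB : ¬ (B y = b ∧ LevGE pt (st B pr pt b) (n + 1) y))
    (hl : LevGE pt (st B (skip B pr pt b (n + 1)) pt b) j y) : LevGE pt (st B pr pt b) j y := by
  induction j generalizing y with
  | zero => trivial
  | succ j ih =>
    rcases j with _ | j
    · simpa only [LevGE, st_skip_of_not hB] using hl
    · obtain ⟨c, hc, hcr, ha, hcl⟩ := hl
      rw [st_skip_of_not hB] at hc ha
      have hstm := h.st_mem b hy h0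
      have hcm := h.view_skip_subset hlev hstm hc
      have := hcr.2.1
      refine ⟨c, hcm, hcr, (h.act_skip hlev hstm hc).1 ha,
        ih (h.mem_of_mem_view hstm hcm) (by omega) ?_ hcl⟩
      rintro ⟨-, hce⟩
      exact (h.of_mem hy).not_cross_top h0 (fun w hw => hlev w (anc_subset hy hw)) hce hcm hcr

/-- Skipping lowers the level. -/
theorem not_levGE_skip {y : ℕ} (hy : y ∈ anc pr x) (h0 : y ≠ 0) (hB : B y = b) :
    ¬ LevGE pt (st B (skip B pr pt b (n + 1)) pt b) (n + 1) y := by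
  intro hl
  by_cases htop : B y = b ∧ LevGE pt (st B pr pt b) (n + 1) y
  · have hs := st_skip_top htop.1 htop.2
    rcases n with _ | n
    · exact hl hs.symm
    · obtain ⟨c, hc, hcr, -⟩ := hl
      rw [hs] at hc
      have := le_of_mem_anc hc
      have := hcr.2.1
      omega
  · exact htop ⟨hB, h.levGE_of_skip hlev hy h0 htop hl⟩

/-- The branch of the tree behaves like a stack: a top move returns to its target, which is still on
the branch of the preceding position, so positions are only popped. -/
theorem mem_stack_skip {u w z : ℕ} (hu : u ∈ anc pr x) (hw : w ∈ anc pr x) (huw : u ≤ w)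
    (hz : z ∈ anc (skip B pr pt b (n + 1)) w) (hzu : z ≤ u) :
    z ∈ anc (skip B pr pt b (n + 1)) u := by
  refine mem_stack_of_le (R := anc (skip B pr pt b (n + 1))) h.pr_lt ?_ hu hw huw hz hzu
  intro y hy h0 z hz
  rcases mem_anc_iff.1 hz with rfl | ⟨-, hz'⟩
  · exact Or.inl rfl
  · right
    by_cases htop : B y = b ∧ LevGE pt (st B pr pt b) (n + 1) y
    · rw [skip_top htop.1 htop.2] at hz'
      have hprm := h.pr_mem hy h0
      have h1 := h.visible y hy h0
      have h2 := (h.good_skip hlev hy).visible y (self_mem_anc _ _) h0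
      rw [skip_top htop.1 htop.2] at h2
      have h3 : pt y ∈ anc (st B (skip B pr pt b (n + 1)) pt b) (pr y) := by
        have hh := (h.of_mem hprm).mem_view_skip (fun w hw => hlev w (anc_subset hprm hw)) (pt y)
        rw [hh]
        rw [htop.1] at h1
        refine ⟨h1, fun e he _ hel hsp => ?_⟩
        have := le_of_mem_anc he
        have := h.pr_lt y hy h0
        exact (h.of_mem hy).not_cross_top h0 (fun w hw => hlev w (anc_subset hy hw)) hel
          (by rwa [st_own htop.1]) ⟨hsp.1, hsp.2, by omega⟩
      exact anc_subset ((h.good_skip hlev hprm).view_subset b h3) hz'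
    · rwa [skip_of_not htop] at hz'

/-- If `y < z`, then `z` is a top move pointing back to `a`. The position `u` right after `a` in the
thinned view before `z` is another child of `a`, and `u < y` would put `u` back on the branch of `y`
above `a`. So `y ≤ u < z`, and the argument repeats from `u`. -/
theorem sibling_mem_view {a z y : ℕ} (haB : B a = !b)
    (hz : z ∈ anc pr x) (hz0 : z ≠ 0) (hza : skip B pr pt b (n + 1) z = a)
    (hy : y ∈ anc pr x) (hy0 : y ≠ 0) (hya : skip B pr pt b (n + 1) y = a) (hyz : y ≤ z) :
    y ∈ anc (st B pr pt b) z := by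
  classical
  induction z using Nat.strong_induction_on with
  | _ z ih =>
    rcases hyz.eq_or_lt with rfl | hlt
    · exact self_mem_anc _ _
    have hay : a < y := hya ▸ h.skip_lt hy hy0
    have hBz : B z = b := by
      have := (h.good_skip hlev hz).owner_pr z (self_mem_anc _ _) hz0
      rw [hza, haB] at this; simpa using this.symm
    have hprz := h.pr_lt z hz hz0
    have hprm := h.pr_mem hz hz0
    have hypr := le_of_mem_anc (mem_anc_next hz hy hlt).2
    have htop : B z = b ∧ LevGE pt (st B pr pt b) (n + 1) z := by
      by_contra hnt
      rw [skip_of_not hnt] at hza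
      omega
    have hpt : pt z = a := by rw [← hza, skip_top htop.1 htop.2]
    have hav : a ∈ anc (st B (skip B pr pt b (n + 1)) pt b) (pr z) := by
      rw [(h.of_mem hprm).mem_view_skip fun w hw => hlev w (anc_subset hprm hw)]
      have h1 := h.visible z hz hz0
      rw [hBz, hpt] at h1
      refine ⟨h1, fun e he _ hel hsp => ?_⟩
      have := le_of_mem_anc he
      exact (h.of_mem hz).not_cross_top hz0 (fun w hw => hlev w (anc_subset hz hw)) hel
        (by rwa [st_own hBz]) ⟨hpt ▸ hsp.1, hpt ▸ hsp.2, by omega⟩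
    obtain ⟨u, hu, hua, hau⟩ := exists_child hav (by omega)
    have huv := h.view_skip_subset hlev hprm hu
    have hum := h.mem_of_mem_view hprm huv
    have hule := le_of_mem_anc huv
    have hBu : B u = b := by
      have := (h.good_skip hlev hum).owner_st b (self_mem_anc _ _) (by omega : u ≠ 0)
      rw [hua, haB] at this; simpa using this.symm
    have hua' : skip B pr pt b (n + 1) u = a := by rwa [st_own hBu] at hua
    have huz : u ∈ anc (st B pr pt b) z :=
      mem_anc_iff.2 (Or.inr ⟨h.st_lt b hz hz0, by rwa [st_own hBz]⟩)
    have hyu : y ≤ u := by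
      by_contra hcon
      have := h.mem_stack_skip hlev hy hprm hypr
        ((h.good_skip hlev hprm).view_subset b hu) (by omega)
      have := (mem_anc_next (self_mem_anc _ y) this (by omega)).2
      rw [hya] at this
      have := le_of_mem_anc this
      omega
    exact anc_subset huz (ih u (by omega) hum (by omega) hua' hyu)

/-- Children that belong to the adversary of `b` have `a` as their immediate predecessor, so there
is at most one. Children that belong to `b` all lie in the view of `b` at the last of them. -/
theorem card_children_skip (hk : 1 ≤ k) (a : ℕ) :
    ((anc pr x).filter fun y => y ≠ 0 ∧ skip B pr pt b (n + 1) y = a).card ≤ k := by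
  classical
  set C := (anc pr x).filter fun y => y ≠ 0 ∧ skip B pr pt b (n + 1) y = a with hC
  rcases C.eq_empty_or_nonempty with he | hne
  · simp [he]
  have hmem : ∀ y ∈ C, y ∈ anc pr x ∧ y ≠ 0 ∧ skip B pr pt b (n + 1) y = a := fun y hy =>
    by simpa [hC] using hy
  have hown : ∀ y ∈ C, B y = !B a := fun y hy => by
    obtain ⟨h1, h2, h3⟩ := hmem y hy
    have := (h.good_skip hlev h1).owner_pr y (self_mem_anc _ _) h2
    rw [h3] at this; simp [this]
  by_cases haB : B a = b
  · refine (Finset.card_le_one.2 fun y hy z hz => ?_).trans hk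
    have key : ∀ y ∈ C, pr y = a := fun y hy => by
      rw [← (hmem y hy).2.2, skip_of_not]
      rintro ⟨h1, -⟩
      have := hown y hy
      rw [h1, haB] at this; simp at this
    have hy' := hmem y hy
    have hz' := hmem z hz
    have hay := h.pr_lt y hy'.1 hy'.2.1
    have haz := h.pr_lt z hz'.1 hz'.2.1
    rw [key y hy] at hay
    rw [key z hz] at haz
    rcases lt_trichotomy y z with hlt | heq | hlt
    · have := le_of_mem_anc (mem_anc_next hz'.1 hy'.1 hlt).2
      rw [key z hz] at this; omega
    · exact heq
    · have := le_of_mem_anc (mem_anc_next hy'.1 hz'.1 hlt).2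
      rw [key y hy] at this; omega
  · have haB' : B a = !b := by revert haB; cases B a <;> cases b <;> simp
    have hzC := C.max'_mem hne
    obtain ⟨h1, h2, h3⟩ := hmem _ hzC
    have hBz : B (C.max' hne) = b := by rw [hown _ hzC, haB']; simp
    refine (Finset.card_le_card fun y hy => ?_).trans (hBz ▸ h.bounded _ h1)
    obtain ⟨h4, h5, h6⟩ := hmem y hy
    exact h.sibling_mem_view hlev haB' h1 h2 h3 h4 h5 h6 (C.le_max' y hy)

end Skip

/-- A player who never backtracks shows everything to the adversary. -/
theorem card_le_of_not_levGE_one (h : Good B pr pt k x) {b : Bool}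
    (hlev : ∀ y ∈ anc pr x, y ≠ 0 → B y = b → ¬ LevGE pt (st B pr pt b) 1 y) :
    (anc pr x).card ≤ k + 1 := by
  have key : ∀ y ∈ anc pr x, anc pr y = anc (st B pr pt (!b)) y := fun y hy => by
    refine anc_congr fun z hz h0 => ?_
    have hz' := anc_subset hy hz
    by_cases hB : B z = b
    · have := hlev z hz' h0 hB
      rw [st_other (by simp [hB])]
      simp only [LevGE, not_not, st_own hB] at this
      exact this.symm
    · rw [st_own]
      revert hB; cases B z <;> cases b <;> simp
  have hx := self_mem_anc pr x
  by_cases hB : B x = !b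
  · rw [key x hx, ← hB]
    exact (h.bounded x hx).trans (Nat.le_succ _)
  -- The adversary's view is bounded only at the adversary's own moves; the last move of `b`
  -- accounts for the `+ 1`.
  · rcases Nat.eq_zero_or_pos x with rfl | hx0
    · rw [anc_zero]; simp
    have hlt := h.pr_lt x hx hx0.ne'
    have hprm := h.pr_mem hx hx0.ne'
    have hBp : B (pr x) = !b := by
      rw [h.owner_pr x hx hx0.ne']; revert hB; cases B x <;> cases b <;> simp
    rw [card_anc_of_lt hlt, key _ hprm, ← hBp]
    exact Nat.succ_le_succ (h.bounded _ hprm)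

/-- The length of a play in which the views of one player have level at most `n`. -/
theorem card_le_of_level (h : Good B pr pt k x) (hk : 1 ≤ k) {b : Bool} {n : ℕ}
    (hlev : ∀ y ∈ anc pr x, y ≠ 0 → B y = b → ¬ LevGE pt (st B pr pt b) (n + 1) y) :
    (anc pr x).card ≤ tower (2 * k) n + 1 := by
  induction n generalizing pr x with
  | zero =>
    refine (h.card_le_of_not_levGE_one hlev).trans ?_
    simp only [tower]; omega
  | succ n ih =>
    refine (card_le_of_tree _ (skip B pr pt b (n + 1)) (tower (2 * k) n + 1) k
      (fun y hy h0 => ⟨h.skip_lt hy h0, h.skip_mem hy h0⟩)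
      (fun y hy => ih (h.good_skip hlev hy) fun z hz h0 hB =>
        h.not_levGE_skip hlev (h.anc_skip_subset hy hz) h0 hB)
      fun a _ => h.card_children_skip hlev hk a).trans ?_
    -- The factor `f + 1` is absorbed by `2 ^ f`; this is why the base is `2 * k`.
    refine (sum_pow_le k _ hk).trans ((Nat.mul_le_mul_right _ ?_).trans
      (?_ : 2 ^ tower (2 * k) n * k ^ tower (2 * k) n ≤ _))
    · exact Nat.lt_two_pow_self
    · rw [← mul_pow]; exact Nat.le_succ _

end Good

end CHO

/-! ### The bound by the depth of the arena. -/

namespace CHO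

variable {B : ℕ → Bool} {pr pt dep : ℕ → ℕ} {k x D : ℕ}

/-- The last position that remains when the moves of depth `D` are removed, together with
everything back to their targets. -/
def top (pr pt dep : ℕ → ℕ) (D : ℕ) (y : ℕ) : ℕ :=
  if dep y = D then if _h : pr (pt y) < y then top pr pt dep D (pr (pt y)) else y else y
  termination_by y

theorem top_of_ne {y : ℕ} (h : dep y ≠ D) : top pr pt dep D y = y := by
  rw [top, if_neg h]

/-- The predecessor among the remaining positions. -/
def cut (pr pt dep : ℕ → ℕ) (D : ℕ) (y : ℕ) : ℕ := top pr pt dep D (pr y)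

/-- The depths of the positions of a play, `D` being the maximal one, and `b` the owner of the
moves of that depth. -/
structure Depth (B : ℕ → Bool) (pr pt dep : ℕ → ℕ) (D x : ℕ) (b : Bool) : Prop where
  zero : dep 0 = 1
  succ : ∀ y ∈ anc pr x, y ≠ 0 → dep y = dep (pt y) + 1
  le : ∀ y ∈ anc pr x, dep y ≤ D
  owner : ∀ y ∈ anc pr x, B y = b ↔ dep y % 2 = D % 2

namespace Good

variable {b : Bool} (h : Good B pr pt k x) (hD : 3 ≤ D) (d : Depth B pr pt dep D x b)
include h hD d

omit h hD in
theorem owner_leaf {y : ℕ} (hy : y ∈ anc pr x) (hl : dep y = D) : B y = b :=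
  (d.owner y hy).2 (by rw [hl])

omit h in
theorem leaf_ne_zero {y : ℕ} (hl : dep y = D) : y ≠ 0 := by
  rintro rfl
  have := d.zero; omega

/-- The target of a leaf has depth `D - 1 ≥ 2`, so it is not the first move and something precedes
it. -/
theorem target_props {y : ℕ} (hy : y ∈ anc pr x) (hl : dep y = D) :
    pt y ∈ anc pr x ∧ pt y < y ∧ pt y ≠ 0 ∧ dep (pt y) ≠ D ∧ pr (pt y) < pt y ∧
      pr (pt y) ∈ anc pr x := by
  have h0 := leaf_ne_zero hD d hl
  have hm := h.pt_mem hy h0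
  have h1 := d.succ y hy h0
  have h2 : pt y ≠ 0 := by
    intro h2
    have := d.zero
    rw [h2] at h1; omega
  exact ⟨hm, h.pt_lt hy h0, h2, by omega, h.pr_lt _ hm h2, h.pr_mem hm h2⟩

theorem top_of_leaf {y : ℕ} (hy : y ∈ anc pr x) (hl : dep y = D) :
    top pr pt dep D y = cut pr pt dep D (pt y) := by
  obtain ⟨-, h1, -, -, h2, -⟩ := h.target_props hD d hy hl
  rw [top, if_pos hl, dif_pos (h2.trans h1), cut]

theorem top_props {y : ℕ} (hy : y ∈ anc pr x) :
    top pr pt dep D y ∈ anc pr x ∧ top pr pt dep D y ≤ y ∧ dep (top pr pt dep D y) ≠ D ∧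
      B (top pr pt dep D y) = B y := by
  induction y using Nat.strong_induction_on with
  | _ y ih =>
    by_cases hl : dep y = D
    · obtain ⟨h1, h2, h3, h4, h5, h6⟩ := h.target_props hD d hy hl
      rw [h.top_of_leaf hD d hy hl, cut]
      obtain ⟨h7, h8, h9, h10⟩ := ih _ (h5.trans h2) h6
      refine ⟨h7, by omega, h9, ?_⟩
      rw [h10, h.owner_pr _ h1 h3, h.owner_pt _ hy (leaf_ne_zero hD d hl), Bool.not_not]
    · rw [top_of_ne hl]
      exact ⟨hy, le_rfl, hl, rfl⟩

theorem cut_props {y : ℕ} (hy : y ∈ anc pr x) (h0 : y ≠ 0) :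
    cut pr pt dep D y ∈ anc pr x ∧ cut pr pt dep D y < y ∧ dep (cut pr pt dep D y) ≠ D ∧
      B (cut pr pt dep D y) = !B y := by
  obtain ⟨h1, h2, h3, h4⟩ := h.top_props hD d (h.pr_mem hy h0)
  exact ⟨h1, h2.trans_lt (h.pr_lt y hy h0), h3, h4.trans (h.owner_pr y hy h0)⟩

-- A move of `b` is preceded by an adversary move, which has the wrong parity of depth to be a leaf.
-- In consequence cutting does not affect the views of `b`.
omit hD in
theorem cut_eq_pr {y : ℕ} (hy : y ∈ anc pr x) (h0 : y ≠ 0) (hB : B y = b) :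
    cut pr pt dep D y = pr y := by
  refine top_of_ne fun hl => ?_
  have h1 := owner_leaf d (h.pr_mem hy h0) hl
  rw [h.owner_pr y hy h0, hB] at h1
  simp at h1

theorem anc_cut {y z : ℕ} (hy : y ∈ anc pr x) (hyl : dep y ≠ D)
    (hz : z ∈ anc (cut pr pt dep D) y) : z ∈ anc pr x ∧ dep z ≠ D := by
  induction y using Nat.strong_induction_on with
  | _ y ih =>
    rcases mem_anc_iff.1 hz with rfl | ⟨h1, h2⟩
    · exact ⟨hy, hyl⟩
    · have hc := h.cut_props hD d hy (by omega)
      exact ih _ h1 hc.1 hc.2.2.1 h2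

omit hD in
theorem st_cut {y : ℕ} (hy : y ∈ anc pr x) (h0 : y ≠ 0) :
    st B (cut pr pt dep D) pt b y = st B pr pt b y := by
  by_cases hB : B y = b
  · rw [st_own hB, st_own hB, h.cut_eq_pr d hy h0 hB]
  · rw [st_other hB, st_other hB]

omit hD in
theorem view_cut {y : ℕ} (hy : y ∈ anc pr x) :
    anc (st B (cut pr pt dep D) pt b) y = anc (st B pr pt b) y :=
  (anc_congr fun _ hz h0 => (h.st_cut d (h.mem_of_mem_view hy hz) h0).symm).symm

omit h hD d in
theorem eq_not {c b : Bool} (h : c ≠ b) : c = !b := by revert h; cases c <;> cases b <;> simp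

/-- The adversary's view at a leaf `w` runs through `w`, `pt w`, `pr (pt w)`, the same jump that
`top` makes; cutting just drops such pairs. -/
theorem view_top_subset {w : ℕ} (hw : w ∈ anc pr x) :
    anc (st B (cut pr pt dep D) pt (!b)) (top pr pt dep D w) ⊆ anc (st B pr pt (!b)) w := by
  induction w using Nat.strong_induction_on with
  | _ w ih =>
    by_cases hl : dep w = D
    · obtain ⟨h1, h2, h3, h4, h5, h6⟩ := h.target_props hD d hw hl
      have h0 := leaf_ne_zero hD d hl
      have hB := owner_leaf d hw hl
      rw [h.top_of_leaf hD d hw hl, cut]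
      refine (ih _ (h5.trans h2) h6).trans ?_
      rw [anc_of_lt (x := w) (h.st_lt _ hw h0), st_other (b := !b) (y := w) (by simp [hB]),
        anc_of_lt (x := pt w) (h.st_lt _ h1 h3),
        st_own (b := !b) (y := pt w) (by rw [h.owner_pt w hw h0, hB])]
      exact (Finset.subset_insert _ _).trans (Finset.subset_insert _ _)
    · rw [top_of_ne hl]
      intro z hz
      rcases mem_anc_iff.1 hz with rfl | ⟨h1, h2⟩
      · exact self_mem_anc _ _
      have h0 : w ≠ 0 := by omega
      refine mem_anc_iff.2 (Or.inr ⟨h.st_lt _ hw h0, ?_⟩)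
      by_cases hB : B w = !b
      · rw [st_own hB] at h2 ⊢
        exact ih _ (h.pr_lt w hw h0) (h.pr_mem hw h0) h2
      · rw [st_other hB] at h2 ⊢
        have hpm := h.pt_mem hw h0
        refine ih _ (h.pt_lt hw h0) hpm ?_
        rwa [top_of_ne]
        intro hl'
        have := d.succ w hw h0
        have := d.le w hw
        omega

theorem view_cut_not_subset {w : ℕ} (hw : w ∈ anc pr x) (hl : dep w ≠ D) :
    anc (st B (cut pr pt dep D) pt (!b)) w ⊆ anc (st B pr pt (!b)) w := by
  have := h.view_top_subset hD d hw
  rwa [top_of_ne hl] at this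

/-- Of the pairs dropped from the adversary's view, one member is a leaf and the other belongs to
the adversary. Targets of remaining adversary moves are neither, which saves visibility. -/
theorem mem_view_top {w z : ℕ} (hw : w ∈ anc pr x) (hz : z ∈ anc (st B pr pt (!b)) w)
    (hzB : B z = b) (hzl : dep z ≠ D) :
    z ∈ anc (st B (cut pr pt dep D) pt (!b)) (top pr pt dep D w) := by
  induction w using Nat.strong_induction_on with
  | _ w ih =>
    rcases mem_anc_iff.1 hz with rfl | ⟨hst, hz'⟩
    · rw [top_of_ne hzl]; exact self_mem_anc _ _
    have h0 : w ≠ 0 := by omega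
    by_cases hl : dep w = D
    · obtain ⟨h1, h2, h3, h4, h5, h6⟩ := h.target_props hD d hw hl
      have hB := owner_leaf d hw hl
      have hpB := h.owner_pt w hw h0
      rw [st_other (b := !b) (y := w) (by simp [hB])] at hz'
      rcases mem_anc_iff.1 hz' with rfl | ⟨hst', hz''⟩
      · rw [hzB, hB] at hpB; simp at hpB
      · rw [st_own (b := !b) (y := pt w) (by rw [hpB, hB])] at hz''
        rw [h.top_of_leaf hD d hw hl, cut]
        exact ih _ (h5.trans h2) h6 hz''
    · rw [top_of_ne hl]
      have hc := h.cut_props hD d hw h0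
      by_cases hB : B w = !b
      · rw [st_own hB] at hz'
        refine mem_anc_iff.2 (Or.inr ?_)
        rw [st_own hB]
        exact ⟨hc.2.1, ih _ (h.pr_lt w hw h0) (h.pr_mem hw h0) hz'⟩
      · rw [st_other hB] at hz'
        refine mem_anc_iff.2 (Or.inr ?_)
        rw [st_other hB]
        have := ih _ (h.pt_lt hw h0) (h.pt_mem hw h0) hz'
        rw [top_of_ne] at this
        · exact ⟨h.pt_lt hw h0, this⟩
        · have := d.succ w hw h0
          have := d.le w hw
          omega

theorem good_cut {y : ℕ} (hy : y ∈ anc pr x) (hyl : dep y ≠ D) :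
    Good B (cut pr pt dep D) pt k y where
  pr_lt z hz h0 := (h.cut_props hD d (h.anc_cut hD d hy hyl hz).1 h0).2.1
  owner_pr z hz h0 := (h.cut_props hD d (h.anc_cut hD d hy hyl hz).1 h0).2.2.2
  owner_pt z hz h0 := h.owner_pt z (h.anc_cut hD d hy hyl hz).1 h0
  visible z hz h0 := by
    obtain ⟨hz', hzl⟩ := h.anc_cut hD d hy hyl hz
    have hv := h.visible z hz' h0
    by_cases hB : B z = b
    · rw [hB] at hv ⊢
      rwa [h.cut_eq_pr d hz' h0 hB, h.view_cut d (h.pr_mem hz' h0)]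
    · have hB' := eq_not hB
      rw [hB'] at hv ⊢
      refine h.mem_view_top hD d (h.pr_mem hz' h0) hv ?_ ?_
      · rw [h.owner_pt z hz' h0, hB', Bool.not_not]
      · have := d.succ z hz' h0
        have := d.le z hz'
        omega
  bounded z hz := by
    obtain ⟨hz', hzl⟩ := h.anc_cut hD d hy hyl hz
    have hb := h.bounded z hz'
    by_cases hB : B z = b
    · rw [hB] at hb ⊢
      rwa [h.view_cut d hz']
    · rw [eq_not hB] at hb ⊢
      exact (Finset.card_le_card (h.view_cut_not_subset hD d hz' hzl)).trans hb

theorem depth_cut {y : ℕ} (hy : y ∈ anc pr x) (hyl : dep y ≠ D) :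
    Depth B (cut pr pt dep D) pt dep (D - 1) y (!b) where
  zero := d.zero
  succ z hz h0 := d.succ z (h.anc_cut hD d hy hyl hz).1 h0
  le z hz := by
    obtain ⟨hz', hzl⟩ := h.anc_cut hD d hy hyl hz
    have := d.le z hz'
    omega
  owner z hz := by
    have := d.owner z (h.anc_cut hD d hy hyl hz).1
    have h1 : (B z = !b) ↔ ¬ B z = b := by cases B z <;> cases b <;> simp
    rw [h1, this]
    omega

/-- A leaf returns to a position below its target, and by visibility the target is still on the
branch of the preceding position; so again positions are only popped. -/
theorem mem_stack_cut {u w z : ℕ} (hu : u ∈ anc pr x) (hw : w ∈ anc pr x) (huw : u ≤ w)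
    (hz : z ∈ anc (cut pr pt dep D) (top pr pt dep D w)) (hzu : z ≤ u) :
    z ∈ anc (cut pr pt dep D) (top pr pt dep D u) := by
  refine mem_stack_of_le (R := fun w => anc (cut pr pt dep D) (top pr pt dep D w))
    h.pr_lt ?_ hu hw huw hz hzu
  intro y hy h0 z hz
  by_cases hl : dep y = D
  · right
    obtain ⟨h1, h2, h3, h4, h5, h6⟩ := h.target_props hD d hy hl
    rw [h.top_of_leaf hD d hy hl] at hz
    have hB := owner_leaf d hy hl
    have hv := h.visible y hy h0
    have hprm := h.pr_mem hy h0
    have hc := h.cut_eq_pr d hy h0 hB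
    have hprl := (h.cut_props hD d hy h0).2.2.1
    rw [hc] at hprl
    rw [hB, ← h.view_cut d hprm] at hv
    have hv' := (h.good_cut hD d hprm hprl).view_subset b hv
    rw [top_of_ne hprl]
    exact anc_subset (next_mem_anc hv' (h.cut_props hD d h1 h3).2.1) hz
  · rw [top_of_ne hl] at hz
    rcases mem_anc_iff.1 hz with rfl | ⟨-, hz'⟩
    · exact Or.inl rfl
    · exact Or.inr hz'

/-- The target of a leaf `y` is among the remaining positions just before `y`. -/
theorem target_mem_stack {y : ℕ} (hy : y ∈ anc pr x) (hl : dep y = D) :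
    pt y ∈ anc (cut pr pt dep D) (top pr pt dep D (pr y)) := by
  have h0 := leaf_ne_zero hD d hl
  have hB := owner_leaf d hy hl
  have hv := h.visible y hy h0
  have hprm := h.pr_mem hy h0
  have hprl := (h.cut_props hD d hy h0).2.2.1
  rw [h.cut_eq_pr d hy h0 hB] at hprl
  rw [hB, ← h.view_cut d hprm] at hv
  rw [top_of_ne hprl]
  exact (h.good_cut hD d hprm hprl).view_subset b hv

/-- The leaf `y` pops its target for good, whereas `z` would need the same target on the branch just
before it. -/
theorem target_injOn {y z : ℕ} (hy : y ∈ anc pr x) (hyl : dep y = D) (hz : z ∈ anc pr x)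
    (hzl : dep z = D) (he : pt y = pt z) : ¬ y < z := by
  intro hlt
  have h1 := h.target_mem_stack hD d hz hzl
  have hzm := (mem_anc_next hz hy hlt).2
  obtain ⟨h2, h3, h4, -⟩ := h.target_props hD d hy hyl
  have := h.mem_stack_cut hD d hy (h.pr_mem hz (leaf_ne_zero hD d hzl)) (le_of_mem_anc hzm) h1
    (by omega)
  rw [h.top_of_leaf hD d hy hyl, ← he] at this
  have := le_of_mem_anc this
  have := (h.cut_props hD d h2 h4).2.1
  omega

theorem card_leaves :
    ((anc pr x).filter fun y => dep y = D).card ≤ ((anc pr x).filter fun y => dep y ≠ D).card := by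
  refine Finset.card_le_card_of_injOn pt ?_ ?_
  · intro y hy
    simp only [Finset.coe_filter, Set.mem_ofPred_eq] at hy ⊢
    obtain ⟨h1, -, -, h2, -⟩ := h.target_props hD d hy.1 hy.2
    exact ⟨h1, h2⟩
  · intro y hy z hz he
    simp only [Finset.coe_filter, Set.mem_ofPred_eq] at hy hz
    have h1 := h.target_injOn hD d hy.1 hy.2 hz.1 hz.2 he
    have h2 := h.target_injOn hD d hz.1 hz.2 hy.1 hy.2 he.symm
    omega

/-- If `y < z`, then `pr z` is a leaf. Its target is again a child of `a`, lies in the adversary's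
view at `z`, and by the stack property does not come before `y`; the argument repeats from this
target. -/
theorem sibling_mem_view_cut {a z y : ℕ} (haB : B a = b)
    (hz : z ∈ anc pr x) (hz0 : z ≠ 0) (hzl : dep z ≠ D) (hza : cut pr pt dep D z = a)
    (hy : y ∈ anc pr x) (hy0 : y ≠ 0) (hyl : dep y ≠ D) (hya : cut pr pt dep D y = a)
    (hyz : y ≤ z) : y ∈ anc (st B pr pt (!b)) z := by
  induction z using Nat.strong_induction_on with
  | _ z ih =>
    rcases hyz.eq_or_lt with rfl | hlt
    · exact self_mem_anc _ _
    have hay : a < y := hya ▸ (h.cut_props hD d hy hy0).2.1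
    have hBz : B z = !b := by
      have := (h.cut_props hD d hz hz0).2.2.2
      rw [hza, haB] at this; simp [this]
    have hprm := h.pr_mem hz hz0
    have hypr := le_of_mem_anc (mem_anc_next hz hy hlt).2
    have hpl : dep (pr z) = D := by
      by_contra hnl
      rw [cut, top_of_ne hnl] at hza
      omega
    have hp0 := leaf_ne_zero hD d hpl
    obtain ⟨h1, h2, h3, h4, h5, h6⟩ := h.target_props hD d hprm hpl
    have hac : cut pr pt dep D (pt (pr z)) = a := by
      rw [← hza, ← h.top_of_leaf hD d hprm hpl, cut]
    have huz : pt (pr z) ∈ anc (st B pr pt (!b)) z := by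
      refine mem_anc_iff.2 (Or.inr ⟨h.st_lt _ hz hz0, ?_⟩)
      rw [st_own hBz]
      refine mem_anc_iff.2 (Or.inr ⟨h.st_lt _ hprm hp0, ?_⟩)
      rw [st_other (by rw [h.owner_pr z hz hz0, hBz]; simp)]
      exact self_mem_anc _ _
    have hlt2 := h.pr_lt z hz hz0
    have hyu : y ≤ pt (pr z) := by
      by_contra hcon
      have hyp : y ≠ pr z := by rintro rfl; exact hyl hpl
      have hm := h.target_mem_stack hD d hprm hpl
      have hlt3 : y < pr z := lt_of_le_of_ne hypr hyp
      have hypp := le_of_mem_anc (mem_anc_next (self_mem_anc pr _) (mem_anc_next hz hy hlt).2 hlt3).2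
      have := h.mem_stack_cut hD d hy (h.pr_mem hprm hp0) hypp hm (by omega)
      rw [top_of_ne hyl] at this
      have := (mem_anc_next (self_mem_anc _ y) this (by omega)).2
      rw [hya] at this
      have := le_of_mem_anc this
      have := (h.cut_props hD d h1 h3).2.1
      omega
    exact anc_subset huz (ih _ (h2.trans hlt2) h1 h3 h4 hac hyu)

theorem card_children_cut (hk : 1 ≤ k) (a : ℕ) :
    (((anc pr x).filter fun y => dep y ≠ D).filter fun y =>
      y ≠ 0 ∧ cut pr pt dep D y = a).card ≤ k := by
  set C := ((anc pr x).filter fun y => dep y ≠ D).filter fun y =>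
    y ≠ 0 ∧ cut pr pt dep D y = a with hC
  rcases C.eq_empty_or_nonempty with he | hne
  · simp [he]
  have hmem : ∀ y ∈ C, (y ∈ anc pr x ∧ dep y ≠ D) ∧ y ≠ 0 ∧ cut pr pt dep D y = a :=
    fun y hy => by simpa only [hC, Finset.mem_filter] using hy
  have hown : ∀ y ∈ C, B y = !B a := fun y hy => by
    obtain ⟨⟨h1, h2⟩, h3, h4⟩ := hmem y hy
    have := (h.cut_props hD d h1 h3).2.2.2
    rw [h4] at this; simp [this]
  by_cases haB : B a = b
  · have hzC := C.max'_mem hne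
    obtain ⟨⟨h1, h2⟩, h3, h4⟩ := hmem _ hzC
    have hBz : B (C.max' hne) = !b := by rw [hown _ hzC, haB]
    refine (Finset.card_le_card fun y hy => ?_).trans (hBz ▸ h.bounded _ h1)
    obtain ⟨⟨h5, h6⟩, h7, h8⟩ := hmem y hy
    exact h.sibling_mem_view_cut hD d haB h1 h3 h2 h4 h5 h7 h6 h8 (C.le_max' y hy)
  · refine (Finset.card_le_one.2 fun y hy z hz => ?_).trans hk
    have key : ∀ y ∈ C, pr y = a := fun y hy => by
      obtain ⟨⟨h1, h2⟩, h3, h4⟩ := hmem y hy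
      rw [← h4, h.cut_eq_pr d h1 h3]
      rw [hown y hy, eq_not haB, Bool.not_not]
    have hy' := hmem y hy
    have hz' := hmem z hz
    have hay := h.pr_lt y hy'.1.1 hy'.2.1
    have haz := h.pr_lt z hz'.1.1 hz'.2.1
    rw [key y hy] at hay
    rw [key z hz] at haz
    rcases lt_trichotomy y z with hlt | heq | hlt
    · have := le_of_mem_anc (mem_anc_next hz'.1.1 hy'.1.1 hlt).2
      rw [key z hz] at this; omega
    · exact heq
    · have := le_of_mem_anc (mem_anc_next hy'.1.1 hz'.1.1 hlt).2
      rw [key y hy] at this; omega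

omit h hD d in
theorem two_mul_succ_le (f : ℕ) (hf : 3 ≤ f) : 2 * (f + 1) ≤ 2 ^ f := by
  induction f, hf using Nat.le_induction with
  | base => norm_num
  | succ f _ ih => rw [pow_succ]; omega

omit h hD d in
/-- The length of a play of depth at most `D`. -/
theorem card_le_of_depth (hk : 2 ≤ k) (hD2 : 2 ≤ D) (h : Good B pr pt k x)
    (d : Depth B pr pt dep D x b) : (anc pr x).card ≤ tower (2 * k) (D - 2) + 1 := by
  induction D, hD2 using Nat.le_induction generalizing pr x b with
  | base =>
    -- At depth `2` every move but the first points to the first, so all of them have the same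
    -- owner, and alternation leaves room for only one.
    have h2 : ∀ y ∈ anc pr x, y ≠ 0 → pt y = 0 := fun y hy h0 => by
      by_contra hne
      have h1 := h.pt_mem hy h0
      have h3 := d.succ y hy h0
      have h4 := d.succ _ h1 hne
      have h5 := d.le y hy
      have h6 : dep (pt (pt y)) ≠ 0 := by
        by_cases h7 : pt (pt y) = 0
        · rw [h7, d.zero]; omega
        · rw [d.succ _ (h.pt_mem h1 hne) h7]; omega
      omega
    have h3 : ∀ y ∈ anc pr x, y ≠ 0 → pr y = 0 := fun y hy h0 => by
      by_contra hne
      have h1 := h.owner_pt y hy h0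
      have h4 := h.owner_pt _ (h.pr_mem hy h0) hne
      rw [h2 y hy h0] at h1
      rw [h2 _ (h.pr_mem hy h0) hne, h.owner_pr y hy h0, h1] at h4
      simp at h4
    have : (anc pr x).card ≤ 2 := by
      rcases Nat.eq_zero_or_pos x with rfl | hx
      · rw [anc_zero]; simp
      · have hlt := h.pr_lt x (self_mem_anc _ _) hx.ne'
        rw [card_anc_of_lt hlt, h3 x (self_mem_anc _ _) hx.ne', anc_zero]; simp
    show _ ≤ 2 * k + 1
    omega
  | succ D hD ih =>
    have hD3 : 3 ≤ D + 1 := by omega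
    obtain ⟨e, rfl⟩ := Nat.exists_eq_add_of_le hD
    set f := tower (2 * k) e with hf
    -- Here `2 ≤ k` is used: `2 * (f + 1) ≤ 2 ^ f` requires `3 ≤ f`, and the extra factor `2` pays
    -- for the leaves.
    have hf4 : 4 ≤ f := le_trans (by omega) (le_tower (2 * k) e (by omega))
    have hnodes := card_le_of_tree ((anc pr x).filter fun y => dep y ≠ 2 + e + 1)
      (cut pr pt dep (2 + e + 1)) (f + 1) k
      (fun y hy h0 => by
        rw [Finset.mem_filter] at hy ⊢
        have := h.cut_props hD3 d hy.1 h0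
        exact ⟨this.2.1, this.1, this.2.2.1⟩)
      (fun y hy => by
        rw [Finset.mem_filter] at hy
        have := ih (h.good_cut hD3 d hy.1 hy.2) (h.depth_cut hD3 d hy.1 hy.2)
        rwa [show 2 + e - 2 = e by omega] at this)
      (fun a _ => h.card_children_cut hD3 d (by omega) a)
    have hleaves := h.card_leaves hD3 d
    have hsum := Finset.card_filter_add_card_filter_not (s := anc pr x)
      (fun y => dep y = 2 + e + 1)
    have h1 := hnodes.trans (sum_pow_le k f (by omega))
    have h2 : 2 * ((f + 1) * k ^ f) ≤ (2 * k) ^ f := by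
      rw [mul_pow, ← mul_assoc]
      exact Nat.mul_le_mul_right _ (two_mul_succ_le f (by omega))
    rw [show 2 + e + 1 - 2 = e + 1 by omega]
    show _ ≤ (2 * k) ^ f + 1
    have h3 : (Finset.filter (fun y => ¬ dep y = 2 + e + 1) (anc pr x)).card =
      (Finset.filter (fun y => dep y ≠ 2 + e + 1) (anc pr x)).card := rfl
    omega

end Good

end CHO

/-! ### Levels of view sequences compared with `LevGE`. -/

namespace CHO

section Indices

variable {M : Type*} {v : PointerSeq M} {l : List ℕ} {f pt : ℕ → ℕ} {x : ℕ}

/-- The sequence `v` is formed by the positions in `l`, which are those of the view from `x`. -/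
structure Represents (v : PointerSeq M) (l : List ℕ) (f pt : ℕ → ℕ) (x : ℕ) : Prop where
  sorted : l.Pairwise (· < ·)
  length : v.length = l.length
  mem : ∀ z, z ∈ l ↔ z ∈ anc f x
  next_lt : ∀ y ∈ anc f x, y ≠ 0 → f y < y
  pt_mem : ∀ y ∈ anc f x, y ≠ 0 → pt y ∈ anc f (f y)
  pointer : ∀ a y, l[a]? = some y → ∀ c, pointer v a = some c ↔ y ≠ 0 ∧ l[c]? = some (pt y)

namespace Represents

theorem lt_iff (h : Represents v l f pt x) {a c y z : ℕ} (ha : l[a]? = some y)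
    (hc : l[c]? = some z) : a < c ↔ y < z := by
  obtain ⟨ha', rfl⟩ := List.getElem?_eq_some_iff.1 ha
  obtain ⟨hc', rfl⟩ := List.getElem?_eq_some_iff.1 hc
  have key := List.pairwise_iff_getElem.1 h.sorted
  constructor
  · exact key a c ha' hc'
  · intro hlt
    rcases lt_trichotomy a c with h1 | rfl | h1
    · exact h1
    · exact absurd hlt (lt_irrefl _)
    · exact absurd (key c a hc' ha' h1) (by omega)

theorem mem_anc (h : Represents v l f pt x) {a y : ℕ} (ha : l[a]? = some y) : y ∈ anc f x :=
  (h.mem y).1 (List.mem_of_getElem? ha)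

theorem exists_index (h : Represents v l f pt x) {y : ℕ} (hy : y ∈ anc f x) :
    ∃ a : ℕ, l[a]? = some y := List.mem_iff_getElem?.1 ((h.mem y).2 hy)

theorem pt_mem_anc (h : Represents v l f pt x) {y : ℕ} (hy : y ∈ anc f x) (h0 : y ≠ 0) :
    pt y ∈ anc f x :=
  anc_subset (next_mem_anc hy (h.next_lt y hy h0)) (h.pt_mem y hy h0)

theorem crossedBy_iff (h : Represents v l f pt x) {i j y z : ℕ} (hi : l[i]? = some y)
    (hj : l[j]? = some z) : CrossedBy v i j ↔ Cross pt y z := by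
  constructor
  · rintro ⟨a, b, h1, h2, h3, h4, h5⟩
    rw [h.pointer i y hi] at h1
    rw [h.pointer j z hj] at h2
    exact ⟨(h.lt_iff h1.2 h2.2).1 h3, (h.lt_iff h2.2 hi).1 h4, (h.lt_iff hi hj).1 h5⟩
  · rintro ⟨h1, h2, h3⟩
    have hy0 : y ≠ 0 := by omega
    have hz0 : z ≠ 0 := by omega
    obtain ⟨a, ha⟩ := h.exists_index (h.pt_mem_anc (h.mem_anc hi) hy0)
    obtain ⟨b, hb⟩ := h.exists_index (h.pt_mem_anc (h.mem_anc hj) hz0)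
    exact ⟨a, b, (h.pointer i y hi a).2 ⟨hy0, ha⟩, (h.pointer j z hj b).2 ⟨hz0, hb⟩,
      (h.lt_iff ha hb).2 h1, (h.lt_iff hb hi).2 h2, (h.lt_iff hi hj).2 h3⟩

theorem crossedBy_take_iff {m i j : ℕ} (hi : i < m) (hj : j < m) :
    CrossedBy (v.take m) i j ↔ CrossedBy v i j := by
  simp only [CrossedBy, CHO.pointer, List.getElem?_take_of_lt hi, List.getElem?_take_of_lt hj]

theorem active_iff (h : Represents v l f pt x) {m i w y : ℕ} (hm : l[m]? = some w)
    (hi : l[i]? = some y) (him : i < m) :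
    Active (v.take m) i ↔ Act pt (anc f (f w)) y := by
  induction hn : m - i using Nat.strong_induction_on generalizing i y with
  | _ n ih =>
    subst hn
    have hmlt : m < v.length := by
      rw [h.length]; exact (List.getElem?_eq_some_iff.1 hm).1
    have hlen : (v.take m).length = m := by rw [List.length_take]; omega
    rw [Active, act_iff, hlen]
    constructor
    · intro hA z hz hcr
      have hwm := h.mem_anc hm
      have hwpos : 0 < w := lt_of_le_of_lt (Nat.zero_le _) ((h.lt_iff hi hm).1 him)
      have hfw := h.next_lt w hwm hwpos.ne'
      obtain ⟨j, hj⟩ := h.exists_index (anc_subset (next_mem_anc hwm hfw) hz)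
      have hjm : j < m := (h.lt_iff hj hm).2 ((le_of_mem_anc hz).trans_lt hfw)
      have hij := (h.lt_iff hi hj).2 hcr.2.2
      rw [← ih _ (by omega) hj hjm rfl]
      exact hA j ⟨hij, hjm⟩ ((crossedBy_take_iff him hjm).2 ((h.crossedBy_iff hi hj).2 hcr))
    · rintro hA j ⟨hij, hjm⟩ hcr
      have hjl : j < l.length := by rw [← h.length]; omega
      have hj : l[j]? = some l[j] := List.getElem?_eq_getElem hjl
      rw [ih _ (by omega) hj hjm rfl]
      refine hA _ ?_ ((h.crossedBy_iff hi hj).1 ((crossedBy_take_iff him hjm).1 hcr))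
      exact (mem_anc_next (h.mem_anc hm) (h.mem_anc hj) ((h.lt_iff hj hm).1 hjm)).2

theorem exists_chain (h : Represents v l f pt x) {n i y : ℕ} (hi : l[i]? = some y) (h0 : y ≠ 0)
    (hl : LevGE pt f (n + 1) y) :
    ∃ c : List ℕ, c.length = n ∧ (c ++ [i]).IsChain (InactivatedBy v) := by
  induction n generalizing i y with
  | zero => exact ⟨[], rfl, by simp⟩
  | succ n ih =>
    obtain ⟨z, hz, hcr, ha, hzl⟩ := hl
    have hym := h.mem_anc hi
    obtain ⟨j, hj⟩ := h.exists_index (anc_subset (next_mem_anc hym (h.next_lt y hym h0)) hz)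
    have := hcr.2.1
    obtain ⟨c, hc, hch⟩ := ih hj (by omega) hzl
    refine ⟨c ++ [j], by simp [hc], ?_⟩
    refine List.IsChain.append_overlap hch ?_ (by simp)
    have hji := (h.lt_iff hj hi).2 hcr.2.2
    exact List.isChain_pair.2
      ⟨(h.crossedBy_iff hj hi).2 hcr, (h.active_iff hi hj hji).2 ha⟩

end Represents

theorem bddAbove_chains (i : ℕ) :
    BddAbove {k : ℕ | ∃ c : List ℕ, c.length = k ∧ (c ++ [i]).IsChain (InactivatedBy v)} := by
  refine ⟨i, ?_⟩
  rintro k ⟨c, rfl, hc⟩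
  have h1 : (c ++ [i]).IsChain (· < ·) :=
    hc.imp fun a b hab => by obtain ⟨⟨_, _, _, _, _, _, h⟩, _⟩ := hab; exact h
  have h2 := List.isChain_iff_pairwise.1 h1
  have h3 : c.toFinset ⊆ Finset.range i := fun a ha => by
    rw [List.pairwise_append] at h2
    simpa using h2.2.2 a (by simpa using ha) i (by simp)
  have h4 : c.Nodup := (List.pairwise_append.1 h2).1.imp fun h => h.ne
  have := Finset.card_le_card h3
  rwa [List.toFinset_card_of_nodup h4, Finset.card_range] at this

theorem Represents.succ_le_level (h : Represents v l f pt x) {n i y : ℕ}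
    (hi : l[i]? = some y) (h0 : y ≠ 0) (hl : LevGE pt f (n + 1) y) :
    n + 1 ≤ level v := by
  have hil : i < v.length := by
    rw [h.length]; exact (List.getElem?_eq_some_iff.1 hi).1
  have hm : n + 1 ≤ moveLevel v i := by
    have hym := h.mem_anc hi
    have hfy := h.next_lt y hym h0
    obtain ⟨j, hj⟩ := h.exists_index (next_mem_anc hym hfy)
    have hji := (h.lt_iff hj hi).2 hfy
    have hji' : j = i - 1 := by
      by_contra hne
      have hlt : j < i - 1 := by omega
      have hil' : i - 1 < l.length := by rw [← h.length]; omega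
      have hq : l[i - 1]? = some l[i - 1] := List.getElem?_eq_getElem hil'
      have h1 := (h.lt_iff hj hq).1 hlt
      have h2 := (h.lt_iff hq hi).1 (by omega)
      have := le_of_mem_anc (mem_anc_next hym (h.mem_anc hq) h2).2
      omega
    rw [moveLevel, if_neg]
    · exact Nat.succ_le_succ (le_csSup (bddAbove_chains i) (h.exists_chain hi h0 hl))
    · rintro (rfl | hp)
      · omega
      · rw [h.pointer i y hi, ← hji', hj] at hp
        exact hl.ne_next (by simpa using hp.2.symm)
  exact hm.trans (Finset.le_sup (f := moveLevel v) (Finset.mem_range.2 hil))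

end Indices

end CHO

namespace CHO

/-- The player that corresponds to a Boolean. -/
def toPlayer : Bool → Player
  | true => Player.P
  | false => Player.O

/-- The pointers of a sequence; positions without pointer point to `0`. -/
def ptr {M : Type*} (s : PointerSeq M) (i : ℕ) : ℕ := (pointer s i).getD 0

theorem pointer_eq_some_iff {M : Type*} {s : PointerSeq M} {i j : ℕ} :
    pointer s i = some j ↔ ∃ x, s[i]? = some x ∧ x.2 = some j := by
  rw [pointer, Option.bind_eq_some_iff]

namespace Arena

variable {M : Type*} (A : Arena M)

/-- The owner of the move at a position, as a Boolean. -/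
def own (s : PointerSeq M) (i : ℕ) : Bool :=
  match s[i]? with
  | some x => decide (A.owner x.1 = Player.P)
  | none => false

variable {A} {s : PointerSeq M}

theorem own_eq_iff {i : ℕ} {x : M × Option ℕ} (hx : s[i]? = some x) (b : Bool) :
    own A s i = b ↔ A.owner x.1 = toPlayer b := by
  simp only [own, hx]
  cases b <;> cases A.owner x.1 <;> simp [toPlayer]

theorem own_ne {i j : ℕ} {x y : M × Option ℕ} (hx : s[i]? = some x) (hy : s[j]? = some y)
    (h : A.owner x.1 ≠ A.owner y.1) : own A s i = !own A s j := by
  simp only [own, hx, hy]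
  revert h
  cases A.owner x.1 <;> cases A.owner y.1 <;> simp

theorem IsPlay.pointer_zero (h : A.IsPlay s) : pointer s 0 = none := by
  rcases hs : s[0]? with _ | x
  · simp [pointer, hs]
  · obtain ⟨h0, rfl⟩ := List.getElem?_eq_some_iff.1 hs
    simp [pointer, hs, ((h.1 0 h0).1 rfl).2]

theorem IsPlay.own_zero (h : A.IsPlay s) : own A s 0 = false := by
  rcases hs : s[0]? with _ | x
  · simp [own, hs]
  · obtain ⟨h0, rfl⟩ := List.getElem?_eq_some_iff.1 hs
    rw [own_eq_iff hs]
    exact A.initial_owner _ ((h.1 0 h0).1 rfl).1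

theorem IsPlay.pointer_pos (h : A.IsPlay s) {i : ℕ} (hi : i < s.length) (h0 : i ≠ 0) :
    ∃ hj : ptr s i < i, pointer s i = some (ptr s i) ∧
      A.enables (s[ptr s i]'(hj.trans hi)).1 s[i].1 := by
  obtain ⟨j, hj, h1, h2⟩ := (h.1 i hi).2 (Nat.pos_of_ne_zero h0)
  have h3 : pointer s i = some j :=
    pointer_eq_some_iff.2 ⟨s[i], List.getElem?_eq_getElem hi, h1⟩
  have h4 : ptr s i = j := by rw [ptr, h3]; rfl
  subst h4
  exact ⟨hj, h3, h2⟩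

theorem IsPlay.own_ptr (h : A.IsPlay s) {i : ℕ} (hi : i < s.length) (h0 : i ≠ 0) :
    own A s (ptr s i) = !own A s i := by
  obtain ⟨hj, -, h2⟩ := h.pointer_pos hi h0
  exact own_ne (List.getElem?_eq_getElem _) (List.getElem?_eq_getElem hi) (A.alternation _ _ h2)

theorem IsPlay.own_pred (h : A.IsPlay s) {i : ℕ} (hi : i < s.length) (h0 : i ≠ 0) :
    own A s (i - 1) = !own A s i := by
  have := List.isChain_iff_getElem.1 h.2 (i - 1) (by omega)
  have h1 : i - 1 + 1 = i := by omega
  simp only [h1] at this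
  exact own_ne (List.getElem?_eq_getElem _) (List.getElem?_eq_getElem hi) this

theorem IsPlay.own_eq (h : A.IsPlay s) {i : ℕ} (hi : i < s.length) :
    own A s i = decide (i % 2 = 1) := by
  induction i with
  | zero => simpa using h.own_zero
  | succ i ih =>
    have h1 := h.own_pred hi (by omega)
    rw [Nat.add_sub_cancel, ih (by omega)] at h1
    have h2 : own A s (i + 1) = !decide (i % 2 = 1) := by rw [h1, Bool.not_not]
    rw [h2, ← decide_not, decide_eq_decide]
    omega

theorem viewPos_take (p : Player) {n m : ℕ} (h : n ≤ m) :
    A.viewPos p (s.take m) n = A.viewPos p s n := by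
  induction n using Nat.strong_induction_on with
  | _ n ih =>
    rcases n with _ | n
    · rw [viewPos, viewPos]
    · rw [viewPos, viewPos, List.getElem?_take_of_lt (by omega)]
      rcases hs : s[n]? with _ | x
      · rfl
      · simp only
        rw [ih n (by omega) (by omega)]
        rcases hx : x.2 with _ | j
        · rfl
        · simp only
          split_ifs with h1 h2
          · rfl
          · rw [ih j (by omega) (by omega)]
          · rfl

theorem viewPos_own {p : Player} {n : ℕ} {x : M × Option ℕ} (hx : s[n]? = some x)
    (h : A.owner x.1 = p) : A.viewPos p s (n + 1) = A.viewPos p s n ++ [n] := by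
  rw [viewPos, hx]; simp [h]

theorem IsPlay.viewPos_one (h : A.IsPlay s) (hs : 0 < s.length) (p : Player) :
    A.viewPos p s 1 = [0] := by
  rw [show (1 : ℕ) = 0 + 1 from rfl, viewPos, List.getElem?_eq_getElem hs]
  simp only
  split_ifs
  · rw [viewPos]; rfl
  · simp [((h.1 0 hs).1 rfl).2]

theorem IsPlay.viewPos_succ (h : A.IsPlay s) (b : Bool) {n : ℕ} (hn : n < s.length)
    (h0 : n ≠ 0) :
    A.viewPos (toPlayer b) s (n + 1) =
      A.viewPos (toPlayer b) s (st (own A s) (· - 1) (ptr s) b n + 1) ++ [n] := by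
  have hx := List.getElem?_eq_getElem hn
  by_cases hB : own A s n = b
  · rw [st_own hB, viewPos_own hx ((own_eq_iff hx b).1 hB)]
    simp only [Nat.sub_add_cancel (Nat.pos_of_ne_zero h0)]
  · obtain ⟨hj, h1, h2⟩ := h.pointer_pos hn h0
    have h3 := h.own_ptr hn h0
    rw [st_other hB]
    have hy : s[ptr s n]? = some (s[ptr s n]'(hj.trans hn)) := List.getElem?_eq_getElem _
    have hoj : own A s (ptr s n) = b := by
      rw [h3]; revert hB; cases own A s n <;> cases b <;> simp
    rw [viewPos_own hy ((own_eq_iff hy b).1 hoj), viewPos, hx]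
    simp only
    rw [if_neg (fun h' => hB ((own_eq_iff hx b).2 h'))]
    have h4 : s[n].2 = some (ptr s n) := by
      obtain ⟨x, hx', h5⟩ := pointer_eq_some_iff.1 h1
      rw [hx] at hx'
      cases hx'
      exact h5
    rw [h4]
    simp [hj]

/-- The steps of the views of a play. -/
abbrev step (A : Arena M) (s : PointerSeq M) (b : Bool) : ℕ → ℕ :=
  st (own A s) (· - 1) (ptr s) b

theorem IsPlay.step_lt (h : A.IsPlay s) (b : Bool) {n : ℕ} (hn : n < s.length) (h0 : n ≠ 0) :
    step A s b n < n := by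
  unfold step st; split_ifs
  · simp only; omega
  · exact (h.pointer_pos hn h0).1

theorem IsPlay.viewPos_spec (h : A.IsPlay s) (b : Bool) {n : ℕ} (hn : n < s.length) :
    (A.viewPos (toPlayer b) s (n + 1)).Pairwise (· < ·) ∧
      ∀ z, z ∈ A.viewPos (toPlayer b) s (n + 1) ↔ z ∈ anc (step A s b) n := by
  induction n using Nat.strong_induction_on with
  | _ n ih =>
    rcases Nat.eq_zero_or_pos n with rfl | h0
    · rw [h.viewPos_one hn, anc_zero]; simp
    · have hlt := h.step_lt b hn h0.ne'
      obtain ⟨h1, h2⟩ := ih _ hlt (hlt.trans hn)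
      rw [h.viewPos_succ b hn h0.ne']
      constructor
      · rw [List.pairwise_append]
        refine ⟨h1, by simp, fun z hz y hy => ?_⟩
        have := le_of_mem_anc ((h2 z).1 hz)
        rw [List.mem_singleton] at hy
        omega
      · intro z
        rw [anc_of_lt hlt, List.mem_append, h2, List.mem_singleton, Finset.mem_insert, or_comm]

theorem IsPlay.length_viewPos (h : A.IsPlay s) (b : Bool) {n : ℕ} (hn : n < s.length) :
    (A.viewPos (toPlayer b) s (n + 1)).length = (anc (step A s b) n).card := by
  obtain ⟨h1, h2⟩ := h.viewPos_spec b hn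
  rw [← List.toFinset_card_of_nodup (h1.imp fun h => h.ne)]
  congr 1
  ext z
  rw [List.mem_toFinset, h2]

theorem subSeq_eq_map [Nonempty M] {l : List ℕ} (h : ∀ i ∈ l, i < s.length) :
    ∃ g : ℕ → M, subSeq s l = l.map fun i => (g i, (pointer s i).bind fun j => l.idxOf? j) := by
  refine ⟨fun i => if hi : i < s.length then s[i].1 else Classical.arbitrary M, ?_⟩
  rw [subSeq, ← List.filterMap_eq_map]
  refine List.filterMap_congr fun i hi => ?_
  simp [pointer, h i hi]

theorem IsPlay.length_view (h : A.IsPlay s) (b : Bool) {n : ℕ} (hn : n < s.length) :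
    (A.view (toPlayer b) (s.take (n + 1))).length = (anc (step A s b) n).card := by
  have : Nonempty M := ⟨A.star⟩
  have hlen : (s.take (n + 1)).length = n + 1 := by rw [List.length_take]; omega
  obtain ⟨g, hg⟩ := subSeq_eq_map (s := s.take (n + 1))
    (l := A.viewPos (toPlayer b) s (n + 1)) (fun i hi => by
      rw [hlen]
      exact Nat.lt_succ_of_le (le_of_mem_anc (((h.viewPos_spec b hn).2 i).1 hi)))
  rw [view, hlen, viewPos_take _ le_rfl, hg, List.length_map, h.length_viewPos b hn]

theorem IsPlay.represents_view (h : A.IsPlay s) (b : Bool) {n : ℕ} (hn : n < s.length)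
    (hvis : ∀ y ∈ anc (step A s b) n, y ≠ 0 → ptr s y ∈ anc (step A s b) (step A s b y)) :
    Represents (A.view (toPlayer b) (s.take (n + 1))) (A.viewPos (toPlayer b) s (n + 1))
      (step A s b) (ptr s) n := by
  have : Nonempty M := ⟨A.star⟩
  obtain ⟨h1, h2⟩ := h.viewPos_spec b hn
  have hlen : (s.take (n + 1)).length = n + 1 := by rw [List.length_take]; omega
  have hle : ∀ i ∈ A.viewPos (toPlayer b) s (n + 1), i < n + 1 := fun i hi =>
    Nat.lt_succ_of_le (le_of_mem_anc ((h2 i).1 hi))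
  have hnd : (A.viewPos (toPlayer b) s (n + 1)).Nodup := h1.imp fun h => h.ne
  have hv : A.view (toPlayer b) (s.take (n + 1)) =
      subSeq (s.take (n + 1)) (A.viewPos (toPlayer b) s (n + 1)) := by
    rw [view, hlen, viewPos_take _ le_rfl]
  obtain ⟨g, hg⟩ := subSeq_eq_map (s := s.take (n + 1))
    (l := A.viewPos (toPlayer b) s (n + 1)) (by rw [hlen]; exact hle)
  rw [hv, hg]
  refine ⟨h1, by simp, h2, fun y hy h0 =>
    h.step_lt b (lt_of_le_of_lt (le_of_mem_anc hy) hn) h0, hvis, ?_⟩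
  intro a y hay c
  have hyl := List.mem_of_getElem? hay
  have hyn := hle y hyl
  have hp : pointer (s.take (n + 1)) y = pointer s y := by
    rw [pointer, pointer, List.getElem?_take_of_lt hyn]
  conv_lhs => rw [pointer]
  simp only [List.getElem?_map, hay, Option.map_some, Option.bind_some, hp]
  by_cases h0 : y = 0
  · subst h0
    simp [h.pointer_zero]
  · obtain ⟨-, h3, -⟩ := h.pointer_pos (i := y) (by omega) h0
    rw [h3, Option.bind_some]
    have hpm : ptr s y ∈ A.viewPos (toPlayer b) s (n + 1) := by
      have hy' := (h2 y).1 hyl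
      exact (h2 _).2 (anc_subset (next_mem_anc hy' (h.step_lt b (by omega) h0)) (hvis y hy' h0))
    generalize A.viewPos (toPlayer b) s (n + 1) = l at *
    rw [List.idxOf?_eq_some_iff]
    constructor
    · rintro ⟨hc, hcv, -⟩
      refine ⟨h0, ?_⟩
      rw [List.getElem?_eq_getElem hc]
      simpa using hcv
    · rintro ⟨-, hc⟩
      obtain ⟨hc', hcv⟩ := List.getElem?_eq_some_iff.1 hc
      refine ⟨hc', by simpa using hcv, fun j hj => ?_⟩
      rw [← hcv]
      have := List.pairwise_iff_getElem.1 h1 j c (by omega) hc' hj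
      simpa using this.ne

end Arena

end CHO

namespace CHO

theorem mem_anc_pred {x y : ℕ} : y ∈ anc (· - 1) x ↔ y ≤ x := by
  refine ⟨le_of_mem_anc, fun h => ?_⟩
  induction x with
  | zero => rw [anc_zero]; simpa using h
  | succ x ih =>
    rcases h.eq_or_lt with rfl | h
    · exact self_mem_anc _ _
    · exact mem_anc_iff.2 (Or.inr ⟨by simp, ih (by omega)⟩)

theorem card_anc_pred (x : ℕ) : (anc (· - 1) x).card = x + 1 := by
  rw [show anc (· - 1) x = Finset.range (x + 1) by ext y; rw [mem_anc_pred, Finset.mem_range]; omega,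
    Finset.card_range]

namespace Arena

variable {M : Type*} {A : Arena M} {s : PointerSeq M} {k l : ℕ}
  {T : Bool → Set (PointerSeq M)}

theorem IsPlay.good (h : A.IsPlay s) (hl : s.length = l + 1)
    (hT : ∀ i < s.length, s.take (i + 1) ∈ T (own A s i))
    (hbd : ∀ b, ∀ u ∈ T b, (A.view (toPlayer b) u).length ≤ k)
    (hvis : ∀ b u m, u ≠ [] → u ++ [m] ∈ T b → A.PointsIntoView (toPlayer b) u m) :
    Good (own A s) (· - 1) (ptr s) k l where
  pr_lt y _ h0 := Nat.sub_lt (Nat.pos_of_ne_zero h0) one_pos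
  owner_pr y hy h0 := h.own_pred (by have := le_of_mem_anc hy; omega) h0
  owner_pt y hy h0 := h.own_ptr (by have := le_of_mem_anc hy; omega) h0
  visible y hy h0 := by
    have hyl : y < s.length := by have := le_of_mem_anc hy; omega
    have h1 := hT y hyl
    rw [List.take_add_one, List.getElem?_eq_getElem hyl, Option.toList_some] at h1
    have hne : s.take y ≠ [] := by
      intro h2
      have := congrArg List.length h2
      rw [List.length_take, List.length_nil] at this
      omega
    obtain ⟨j, hj, h2⟩ := hvis _ _ _ hne h1
    have hlen : (s.take y).length = y := by rw [List.length_take]; omega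
    rw [hlen, viewPos_take _ le_rfl] at hj
    have h3 : ptr s y = j := by
      rw [ptr, pointer_eq_some_iff.2 ⟨_, List.getElem?_eq_getElem hyl, h2⟩]; rfl
    rw [h3]
    obtain ⟨z, rfl⟩ := Nat.exists_eq_succ_of_ne_zero h0
    exact ((h.viewPos_spec _ (by omega)).2 j).1 hj
  bounded y hy := by
    have hyl : y < s.length := by have := le_of_mem_anc hy; omega
    rw [← h.length_view _ hyl]
    exact hbd _ _ (hT y hyl)

theorem IsPlay.not_levGE (h : A.IsPlay s) (hl : s.length = l + 1)
    (hT : ∀ i < s.length, s.take (i + 1) ∈ T (own A s i))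
    (hg : Good (own A s) (· - 1) (ptr s) k l) {b : Bool} {n : ℕ}
    (hn : ∀ u ∈ T b, level (A.view (toPlayer b) u) ≤ n) {y : ℕ} (hy : y ∈ anc (· - 1) l)
    (h0 : y ≠ 0) (hB : own A s y = b) : ¬ LevGE (ptr s) (step A s b) (n + 1) y := by
  intro hlev
  have hyl : y < s.length := by have := le_of_mem_anc hy; omega
  have hr := h.represents_view b hyl fun z hz hz0 =>
    hg.pt_mem_view (hg.mem_of_mem_view hy hz) hz0 b
  obtain ⟨a, ha⟩ := hr.exists_index (self_mem_anc _ y)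
  have h1 := hr.succ_le_level ha h0 hlev
  have h2 := hn _ (hB ▸ hT y hyl)
  omega

theorem IsPlay.own_eq_depth (h : A.IsPlay s) {y : ℕ} (hy : y < s.length) :
    own A s y = decide ((anc (ptr s) y).card % 2 = 0) := by
  induction y using Nat.strong_induction_on with
  | _ y ih =>
    rcases Nat.eq_zero_or_pos y with rfl | h0
    · rw [h.own_zero, anc_zero]; simp
    · obtain ⟨hlt, -⟩ := h.pointer_pos hy h0.ne'
      have h1 := h.own_ptr hy h0.ne'
      rw [ih _ hlt (hlt.trans hy)] at h1
      rw [card_anc_of_lt hlt, ← Bool.not_not (own A s y), ← h1, ← decide_not, decide_eq_decide]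
      omega

theorem IsPlay.exists_simplePlay (h : A.IsPlay s) {y : ℕ} (hy : y < s.length) :
    ∃ L : List M, A.IsSimplePlay L ∧ L.length = (anc (ptr s) y).card ∧
      L.getLast? = some s[y].1 := by
  induction y using Nat.strong_induction_on with
  | _ y ih =>
    rcases Nat.eq_zero_or_pos y with rfl | h0
    · exact ⟨[s[0].1], ⟨⟨_, rfl, ((h.1 0 hy).1 rfl).1⟩, by simp⟩, by rw [anc_zero]; simp, rfl⟩
    · obtain ⟨hlt, -, hen⟩ := h.pointer_pos hy h0.ne'
      obtain ⟨L, ⟨⟨m, hm, hmi⟩, hch⟩, hlen, hlast⟩ := ih _ hlt (hlt.trans hy)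
      refine ⟨L ++ [s[y].1], ⟨⟨m, ?_, hmi⟩, ?_⟩, ?_, by simp⟩
      · rw [List.head?_append]
        rw [Option.mem_def] at hm ⊢
        simp [hm]
      · rw [List.isChain_append]
        refine ⟨hch, by simp, fun u hu v hv => ?_⟩
        rw [hlast, Option.mem_some_iff] at hu
        rw [List.head?_cons, Option.mem_some_iff] at hv
        subst hu hv
        exact hen
      · rw [List.length_append, hlen, card_anc_of_lt hlt, List.length_singleton]

theorem IsPlay.depth (h : A.IsPlay s) (hl : s.length = l + 1) {d : ℕ} (hd : A.HasDepth d) :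
    Depth (own A s) (· - 1) (ptr s) (fun y => (anc (ptr s) y).card) d l (decide (d % 2 = 0)) where
  zero := by rw [anc_zero]; simp
  succ y hy h0 := by
    have := le_of_mem_anc hy
    exact card_anc_of_lt (h.pointer_pos (by omega) h0).1
  le y hy := by
    have := le_of_mem_anc hy
    obtain ⟨L, h1, h2, -⟩ := h.exists_simplePlay (y := y) (by omega)
    rw [← h2]
    exact hd.1 L h1
  owner y hy := by
    have := le_of_mem_anc hy
    rw [h.own_eq_depth (by omega), decide_eq_decide]
    omega

theorem take_mem_of_closed {σ : Set (PointerSeq M)} (hσ : ∀ s m n, s ++ [m, n] ∈ σ → s ∈ σ)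
    {u : PointerSeq M} (hu : u ∈ σ) (e : ℕ) {j : ℕ} (hj : j + 2 * e = u.length) :
    u.take j ∈ σ := by
  induction e generalizing j with
  | zero => rwa [List.take_of_length_le (by omega)]
  | succ e ih =>
    have h1 := ih (j := j + 1 + 1) (by omega)
    rw [List.take_add_one, List.take_add_one, List.getElem?_eq_getElem (by omega : j < u.length),
      List.getElem?_eq_getElem (by omega : j + 1 < u.length), List.append_assoc] at h1
    exact hσ _ _ _ h1

theorem take_mem_of_interaction {σ τ : Set (PointerSeq M)} (hσ : A.IsPlayerStrategy σ)
    (hτ : A.IsOpponentStrategy τ) (hs : s ∈ A.interactions σ τ) :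
    A.IsPlay s ∧ ∀ i < s.length, s.take (i + 1) ∈ bif own A s i then σ else τ := by
  obtain ⟨u, m, rfl, hP, hO⟩ := hs
  rcases hm : A.owner m.1 with _ | _
  · obtain ⟨h1, h2⟩ := hP hm
    obtain ⟨hplay, hev⟩ := hσ.1 _ h1
    refine ⟨hplay, fun i hi => ?_⟩
    rw [hplay.own_eq hi]
    simp only [List.length_append, List.length_singleton] at hi hev
    by_cases hodd : i % 2 = 1
    · obtain ⟨e, he⟩ : ∃ e, i + 1 + 2 * e = u.length + 1 :=
        ⟨(u.length - i) / 2, by have := Nat.even_iff.1 hev; omega⟩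
      simpa [hodd] using take_mem_of_closed hσ.2 h1 e (by simpa using he)
    · obtain ⟨e, he⟩ : ∃ e, i + 1 + 2 * e = u.length :=
        ⟨(u.length - i - 1) / 2, by have := Nat.even_iff.1 hev; omega⟩
      have := take_mem_of_closed hτ.2 h2 e he
      rw [List.take_append_of_le_length (by omega)]
      simpa [hodd] using this
  · obtain ⟨h1, h2⟩ := hO hm
    obtain ⟨hplay, hev⟩ := hτ.1 _ h1
    refine ⟨hplay, fun i hi => ?_⟩
    rw [hplay.own_eq hi]
    simp only [List.length_append, List.length_singleton] at hi hev
    by_cases hodd : i % 2 = 1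
    · obtain ⟨e, he⟩ : ∃ e, i + 1 + 2 * e = u.length :=
        ⟨(u.length - i - 1) / 2, by have := Nat.odd_iff.1 hev; omega⟩
      have := take_mem_of_closed hσ.2 h2 e he
      rw [List.take_append_of_le_length (by omega)]
      simpa [hodd] using this
    · obtain ⟨e, he⟩ : ∃ e, i + 1 + 2 * e = u.length + 1 :=
        ⟨(u.length - i) / 2, by have := Nat.odd_iff.1 hev; omega⟩
      simpa [hodd] using take_mem_of_closed hτ.2 h1 e (by simpa using he)

end Arena

theorem hyperexp_eq_tower (a b : ℕ) : hyperexp a b a = tower a b := by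
  induction b with
  | zero => rfl
  | succ b ih => rw [hyperexp, ih, tower, Real.rpow_natCast, Nat.cast_pow]

theorem two_mul_tower_mul_log_le (a b : ℕ) (ha : 2 ≤ a) :
    2 * tower a b * Real.logb 2 a ≤ hyperexp 2 b (a * Real.logb 2 a * 2) := by
  have ha' : (2 : ℝ) ≤ a := by exact_mod_cast ha
  induction b with
  | zero => simp only [hyperexp, tower]; linarith
  | succ b ih =>
    have h1 : (2 : ℝ) ^ Real.logb 2 a = a :=
      Real.rpow_logb (by norm_num) (by norm_num) (by linarith)
    have h2 : Real.logb 2 a ≤ a := by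
      rw [Real.logb_le_iff_le_rpow (by norm_num) (by linarith), Real.rpow_natCast]
      exact_mod_cast Nat.lt_two_pow_self.le
    have h3 : (a : ℝ) ^ 2 ≤ (a : ℝ) ^ tower a b :=
      pow_le_pow_right₀ (by linarith) (ha.trans (le_tower a b ha))
    have h4 : (2 : ℝ) ^ (2 * tower a b * Real.logb 2 a) = (a : ℝ) ^ tower a b * a ^ tower a b := by
      rw [mul_comm, Real.rpow_mul (by norm_num), h1, ← pow_add, ← two_mul]
      exact_mod_cast Real.rpow_natCast (a : ℝ) (2 * tower a b)
    rw [hyperexp, tower, Nat.cast_pow]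
    refine le_trans ?_ (Real.rpow_le_rpow_of_exponent_le (by norm_num) ih)
    rw [h4]
    calc 2 * (a : ℝ) ^ tower a b * Real.logb 2 a
        = (a : ℝ) ^ tower a b * (2 * Real.logb 2 a) := by ring
      _ ≤ (a : ℝ) ^ tower a b * a ^ tower a b := by
        refine mul_le_mul_of_nonneg_left (le_trans ?_ h3) (by positivity)
        nlinarith

theorem tower_le_hyperexp (a b : ℕ) (ha : 2 ≤ a) :
    (tower a b : ℝ) ≤ hyperexp 2 b (a * Real.logb 2 a * 2) := by
  have h1 : 1 ≤ Real.logb 2 a := by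
    rw [Real.le_logb_iff_rpow_le (by norm_num) (by positivity)]
    simpa using (by exact_mod_cast ha : (2 : ℝ) ≤ a)
  have h2 : (0 : ℝ) ≤ tower a b := Nat.cast_nonneg _
  have h3 := two_mul_tower_mul_log_le a b ha
  nlinarith

end CHO

open CHO
theorem mainTheorem3 {M : Type*} (A : Arena M) (σ τ : Set (PointerSeq M)) (n m k d b : ℕ)
    (hσ : A.IsBoundedPlayerStrategy σ k) (hσn : IsBacktracking A Player.P σ n)
    (hτ : A.IsBoundedOpponentStrategy τ k) (hτm : IsBacktracking A Player.O τ m)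
    (hd : A.HasDepth d) (hd2 : 2 ≤ d) (hb : b = min n (min m (d - 2)))
    (s : PointerSeq M) (hs : s ∈ A.interactions σ τ) (l : ℕ) (hl : s.length = l + 1) :
    (l : ℝ) ≤ hyperexp (2 * k) b (2 * k) ∧
      hyperexp (2 * k) b (2 * k) ≤ hyperexp 2 b (2 * k * Real.logb 2 (2 * k) * 2) := by
  obtain ⟨hplay, hT⟩ := Arena.take_mem_of_interaction hσ.1 hτ.1 hs
  have hg : Good (Arena.own A s) (· - 1) (ptr s) k l :=
    hplay.good (T := fun b => bif b then σ else τ) hl hT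
      (by rintro (_ | _); exacts [hτ.2.2, hσ.2.2])
      (by rintro (_ | _) u m' hu hm'; exacts [hτ.2.1 u m' hu hm', hσ.2.1 u m' hm'])
  have hk : 1 ≤ k := card_anc_pos.trans_le (hg.bounded l (self_mem_anc _ _))
  have hk2 : l ≠ 0 → 2 ≤ k := fun hl0 => by
    have h1 := hg.bounded l (self_mem_anc _ _)
    rw [card_anc_of_lt (hg.st_lt _ (self_mem_anc _ _) hl0)] at h1
    have := card_anc_pos (f := st (Arena.own A s) (· - 1) (ptr s) (Arena.own A s l))
      (x := st (Arena.own A s) (· - 1) (ptr s) (Arena.own A s l) l)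
    omega
  have hP : l ≤ tower (2 * k) n := by
    have hlev : ∀ u ∈ σ, level (A.view (toPlayer true) u) ≤ n := fun u hu =>
      hσn.2 ⟨u, hu, rfl⟩
    have := hg.card_le_of_level hk (b := true) (n := n) fun y hy h0 hB =>
      hplay.not_levGE (T := fun b => bif b then σ else τ) (b := true) hl hT hg
        hlev hy h0 hB
    rw [card_anc_pred] at this
    omega
  have hO : l ≤ tower (2 * k) m := by
    have hlev : ∀ u ∈ τ, level (A.view (toPlayer false) u) ≤ m := fun u hu =>
      hτm.2 ⟨u, hu, rfl⟩
    have := hg.card_le_of_level hk (b := false) (n := m) fun y hy h0 hB =>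
      hplay.not_levGE (T := fun b => bif b then σ else τ) (b := false) hl hT hg
        hlev hy h0 hB
    rw [card_anc_pred] at this
    omega
  have hD : l ≤ tower (2 * k) (d - 2) := by
    rcases Nat.eq_zero_or_pos l with rfl | h0
    · exact Nat.zero_le _
    have := Good.card_le_of_depth (hk2 h0.ne') hd2 hg (hplay.depth hl hd)
    rw [card_anc_pred] at this
    omega
  have hmain : l ≤ tower (2 * k) b := by
    rcases min_choice n (min m (d - 2)) with h | h
    · rwa [hb, h]
    · rcases min_choice m (d - 2) with h' | h'
      · rwa [hb, h, h']
      · rwa [hb, h, h']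
  have h1 := hyperexp_eq_tower (2 * k) b
  have h2 := tower_le_hyperexp (2 * k) b (by omega)
  push_cast at h1 h2
  rw [h1]
  exact ⟨by exact_mod_cast hmain, h2⟩
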